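/- For integers $n\ge 2k+1$ and $k\ge 3$, let $K(n,k)$ be the Kneser graph, whose vertices are the $k$-element subsets of $\{1,\dots,n\}$, two of them being adjacent if and only if they are disjoint. Let $S$ be a vertex cut of $K(n,k)$, that is, a set of vertices whose deletion leaves a disconnected graph $K(n,k)\setminus S$, and let $c$ be the number of connected components of $K(n,k)\setminus S$. Then at least one of the following two alternatives holds: 1. $\displaystyle \binom{n-k-1}{k-1}+1\le c\le \binom{n-1}{k-1}-\binom{n-k-1}{k-1}+1$; 2. $\displaystyle \frac{|S|}{c}\ge \frac nk-1$, and equality $\displaystyle \frac{|S|}{c}=\frac nk-1$ holds if and only if $S$ is the complement of an independent set of maximum size in $K(n,k)$. -/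

import Mathlib

/-- The Kneser graph `K(n,k)`: the vertices are the `k`-element subsets of an `n`-element set,
and two distinct vertices are adjacent exactly when they are disjoint. (Distinctness only matters
for `k = 0`, where the empty set is disjoint from itself.) -/
def kneserGraph (n k : ℕ) : SimpleGraph {A : Finset (Fin n) // A.card = k} where
  Adj A B := A ≠ B ∧ Disjoint A.1 B.1
  symm := ⟨fun _ _ h => ⟨h.1.symm, h.2.symm⟩⟩
  loopless := ⟨fun _ h => h.1 rfl⟩

/-- The number of connected components of `G ∖ S`, the graph obtained from `G` by deleting the
vertices in `S`. -/
noncomputable def SimpleGraph.numComponentsDelete {V : Type*} (G : SimpleGraph V)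
    (S : Finset V) : ℕ :=
  Nat.card (G.induce ((S : Set V)ᶜ)).ConnectedComponent

/-- `S` is a vertex cut of `G`: deleting `S` leaves a disconnected graph, i.e. there are two
remaining vertices not joined by a walk in `G ∖ S`. (`Preconnected` does not ask for
non-emptiness, so the set of all vertices is not a vertex cut.) -/
def SimpleGraph.IsVertexCut {V : Type*} (G : SimpleGraph V) (S : Finset V) : Prop :=
  ¬ (G.induce ((S : Set V)ᶜ)).Preconnected

/-! If the complement of `S` is independent, its vertices are the components, `|S| + c = n.choose
k`, and the second alternative is Erdős–Ko–Rado. Otherwise an edge `AB` survives. One vertex from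
each component, with `A` representing its own, gives an intersecting family. Either it has no common
point and Hilton–Milner applies, or it is a star whose other members all meet `B`; both cases give
the upper bound on `c` of the first alternative (`card_components_add_choose_le`).

It remains to treat `c ≤ (n-k-1).choose (k-1)`. The Kneser graph is connected and arc-transitive of
degree `d = (n-k).choose k`, hence `d`-connected (`le_card_outerBoundary`), so `|S| ≥ d` and `|S|/c
≥ (n-k)/k`. Equality would force `|S| = d` and `c = (n-k-1).choose (k-1) ≥ 3`, whereas deleting `d`
vertices from such a graph without twins leaves at most two components (`false_of_three`).

Hilton–Milner is proved by shifting, with a separate treatment of compressions that would create a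
common point. -/

/-! ### Hilton–Milner for left-shifted families -/

/-- A family of sets of naturals is left-shifted if replacing an element of a member by a smaller
one outside of it gives a member again. -/
def IsLeftShifted (𝒜 : Finset (Finset ℕ)) : Prop :=
  ∀ A ∈ 𝒜, ∀ i j, i < j → j ∈ A → i ∉ A → insert i (A.erase j) ∈ 𝒜

/-- A property of subsets of `U` that is stable under shifts passes from any set to an initial
segment `M` of `U` of the same size. -/
theorem initial_of_shift_stable {α : Type*} [DecidableEq α] (r : α → α → Prop) (P : Finset α → Prop)
    (U M : Finset α) (hMU : M ⊆ U) (hM : ∀ i ∈ M, ∀ j ∈ U, j ∉ M → r i j)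
    (hP : ∀ A, P A → A ⊆ U → ∀ i ∈ U, ∀ j ∈ A, r i j → i ∉ A → P (insert i (A.erase j)))
    (A : Finset α) (hA : P A) (hAU : A ⊆ U) (hcard : A.card = M.card) : P M := by
  induction h : (A \ M).card using Nat.strong_induction_on generalizing A with
  | _ m ih =>
    by_cases hAM : A ⊆ M
    · rwa [Finset.eq_of_subset_of_card_le hAM hcard.ge] at hA
    · obtain ⟨j, hjA, hjM⟩ := Finset.not_subset.1 hAM
      have : ¬ M ⊆ A := fun hMA => hAM (Finset.eq_of_subset_of_card_le hMA hcard.le).ge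
      obtain ⟨i, hiM, hiA⟩ := Finset.not_subset.1 this
      refine ih _ ?_ (insert i (A.erase j))
        (hP A hA hAU i (hMU hiM) j hjA (hM i hiM j (hAU hjA) hjM) hiA) ?_ ?_ rfl
      · rw [← h]
        apply Finset.card_lt_card
        refine ⟨fun x => by simp; grind, fun hsub => ?_⟩
        have := hsub (Finset.mem_sdiff.2 ⟨hjA, hjM⟩)
        grind
      · grind
      · rw [Finset.card_insert_of_notMem (by grind), Finset.card_erase_of_mem hjA, ← hcard]
        have := Finset.card_pos.2 ⟨j, hjA⟩
        omega

/-- The number of `r`-subsets of `U` that contain `x` and meet `B`. -/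
theorem card_add_choose_of_star {α : Type*} [DecidableEq α] (𝒜 : Finset (Finset α)) (U B : Finset α)
    (x : α) (r : ℕ) (hx : x ∈ U) (hB : B ⊆ U) (hxB : x ∉ B)
    (h𝒜 : ∀ A ∈ 𝒜, A ⊆ U ∧ A.card = r ∧ x ∈ A ∧ ¬ Disjoint A B) :
    𝒜.card + (U.card - 1 - B.card).choose (r - 1) ≤ (U.card - 1).choose (r - 1) := by
  have hinj : Set.InjOn (fun A : Finset α => A.erase x) 𝒜 := by
    intro A hA A' hA' h
    have h1 := (h𝒜 A hA).2.2.1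
    have h2 := (h𝒜 A' hA').2.2.1
    rw [← Finset.insert_erase h1, ← Finset.insert_erase h2]
    exact congrArg _ h
  have hcardU : (U.erase x).card = U.card - 1 := Finset.card_erase_of_mem hx
  have hcardB : ((U.erase x) \ B).card = U.card - 1 - B.card := by
    rw [Finset.card_sdiff_of_subset, hcardU]
    intro b hb
    exact Finset.mem_erase.2 ⟨fun h => hxB (h ▸ hb), hB hb⟩
  rw [← Finset.card_image_of_injOn hinj, ← hcardB, ← Finset.card_powersetCard, ← hcardU,
    ← Finset.card_powersetCard, ← Finset.card_union_of_disjoint]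
  · apply Finset.card_le_card
    apply Finset.union_subset
    · intro C hC
      obtain ⟨A, hA, rfl⟩ := Finset.mem_image.1 hC
      obtain ⟨h1, h2, h3, h4⟩ := h𝒜 A hA
      refine Finset.mem_powersetCard.2 ⟨Finset.erase_subset_erase _ h1, ?_⟩
      rw [Finset.card_erase_of_mem h3, h2]
    · exact Finset.powersetCard_mono Finset.sdiff_subset
  · rw [Finset.disjoint_left]
    intro C hC hC'
    obtain ⟨A, hA, rfl⟩ := Finset.mem_image.1 hC
    obtain ⟨h1, h2, h3, h4⟩ := h𝒜 A hA
    have h5 := (Finset.mem_powersetCard.1 hC').1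
    apply h4
    rw [Finset.disjoint_left]
    intro y hy hyB
    have := h5 (Finset.mem_erase.2 ⟨fun h => hxB (h ▸ hyB), hy⟩)
    exact (Finset.mem_sdiff.1 this).2 hyB

/-- Without `0`, every element of `A` outside `Icc 1 k` exceeds all of `Icc 1 k`, so left shifts
lead there. The lemma turns non-triviality into a hypothesis that survives the induction on `n`. -/
theorem IsLeftShifted.Icc_mem {𝒜 : Finset (Finset ℕ)} (h : IsLeftShifted 𝒜) {k : ℕ}
    {A : Finset ℕ} (hA : A ∈ 𝒜) (hk : A.card = k) (h0 : 0 ∉ A) : Finset.Icc 1 k ∈ 𝒜 := by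
  refine initial_of_shift_stable (· < ·) (· ∈ 𝒜) (Finset.Icc 1 k ∪ A) (Finset.Icc 1 k)
    Finset.subset_union_left ?_ ?_ A hA Finset.subset_union_right (by simp [hk])
  · intro i hi j hj hjM
    have : j ≠ 0 := by rintro rfl; simp at hj; exact h0 hj
    simp at *
    omega
  · intro B hB _ i _ j hj hij hi
    exact h B hB i j hij hj hi

/-- An intersecting family of half-sized subsets contains at most half of them. -/
theorem card_le_of_intersecting_two_mul (𝒜 : Finset (Finset ℕ)) (k : ℕ) (hk : 0 < k)
    (h𝒜 : ∀ A ∈ 𝒜, A ⊆ Finset.range (2 * k) ∧ A.card = k)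
    (hint : (𝒜 : Set (Finset ℕ)).Intersecting) : 𝒜.card ≤ (2 * k - 1).choose (k - 1) := by
  have hinj : Set.InjOn (fun A : Finset ℕ => Finset.range (2 * k) \ A) 𝒜 := by
    intro A hA A' hA' h
    have h1 := (h𝒜 A hA).1
    have h2 := (h𝒜 A' hA').1
    rw [← Finset.sdiff_sdiff_eq_self h1, ← Finset.sdiff_sdiff_eq_self h2]
    exact congrArg _ h
  -- The complements of the members form a family disjoint from `𝒜`.
  have h2 : 𝒜.card + 𝒜.card ≤ (2 * k).choose k := by
    have e : (2 * k).choose k = ((Finset.range (2 * k)).powersetCard k).card := by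
      rw [Finset.card_powersetCard, Finset.card_range]
    rw [e]
    nth_rewrite 1 [← Finset.card_image_of_injOn hinj]
    rw [← Finset.card_union_of_disjoint]
    · apply Finset.card_le_card
      apply Finset.union_subset
      · intro C hC
        obtain ⟨A, hA, rfl⟩ := Finset.mem_image.1 hC
        obtain ⟨h1, h2⟩ := h𝒜 A hA
        refine Finset.mem_powersetCard.2 ⟨Finset.sdiff_subset, ?_⟩
        rw [Finset.card_sdiff_of_subset h1, h2, Finset.card_range]
        omega
      · intro A hA
        exact Finset.mem_powersetCard.2 (h𝒜 A hA)
    · rw [Finset.disjoint_left]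
      intro C hC hC'
      obtain ⟨A, hA, rfl⟩ := Finset.mem_image.1 hC
      exact hint hA hC' Finset.disjoint_sdiff
  obtain ⟨k, rfl⟩ : ∃ l, k = l + 1 := ⟨k - 1, by omega⟩
  have e : 2 * (k + 1) = (2 * k + 1) + 1 := by ring
  rw [e, Nat.choose_succ_succ, Nat.choose_symm_half] at h2
  have e2 : 2 * (k + 1) - 1 = 2 * k + 1 := by omega
  rw [e2, Nat.add_sub_cancel]
  omega

/-- The Hilton–Milner bound for left-shifted families. -/
theorem IsLeftShifted.card_add_choose_le (n : ℕ) : ∀ (k : ℕ) (𝒜 : Finset (Finset ℕ)), 2 ≤ k →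
    2 * k ≤ n → (∀ A ∈ 𝒜, A ⊆ Finset.range n ∧ A.card = k) →
    (𝒜 : Set (Finset ℕ)).Intersecting → IsLeftShifted 𝒜 → Finset.Icc 1 k ∈ 𝒜 →
    𝒜.card + (n - k - 1).choose (k - 1) ≤ (n - 1).choose (k - 1) + 1 := by
  induction n with
  | zero => intros; omega
  | succ m ih =>
    intro k 𝒜 hk hn h𝒜 hint hsh hIcc
    -- When the ground set has `2 * k` points, the subtracted binomial is `1` and cancels the `+ 1`
    -- on the right.
    rcases hn.eq_or_lt with hn' | hn'
    · have := card_le_of_intersecting_two_mul 𝒜 k (by omega) (by rwa [hn']) hint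
      rw [← hn']
      have e : 2 * k - k - 1 = k - 1 := by omega
      rw [e, Nat.choose_self]
      omega
    have hn : 2 * k ≤ m := by omega
    -- Split at the largest point `m`, with `𝒜₁` the link of `m`. Pascal's rule recombines the
    -- bounds, so only one of them may carry a `+ 1`: the one for `𝒜₀`.
    set 𝒜₀ := 𝒜.filter (fun A => m ∉ A) with h𝒜₀
    set 𝒜₁ := (𝒜.filter (fun A => m ∈ A)).image (fun A => A.erase m) with h𝒜₁
    have mem₁ : ∀ A, A ∈ 𝒜₁ ↔ m ∉ A ∧ insert m A ∈ 𝒜 := by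
      intro A
      simp only [h𝒜₁, Finset.mem_image, Finset.mem_filter]
      constructor
      · rintro ⟨B, ⟨hB, hm⟩, rfl⟩
        exact ⟨by simp, by rwa [Finset.insert_erase hm]⟩
      · rintro ⟨hm, hA⟩
        exact ⟨_, ⟨hA, by simp⟩, Finset.erase_insert hm⟩
    have hcard : 𝒜.card = 𝒜₀.card + 𝒜₁.card := by
      rw [h𝒜₁, Finset.card_image_of_injOn, h𝒜₀, add_comm]
      · exact (Finset.card_filter_add_card_filter_not _).symm
      · intro A hA A' hA' h
        rw [Finset.mem_coe, Finset.mem_filter] at hA hA'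
        rw [← Finset.insert_erase hA.2, ← Finset.insert_erase hA'.2]
        exact congrArg _ h
    have sub₁ : ∀ A ∈ 𝒜₁, A ⊆ Finset.range m ∧ A.card = k - 1 := by
      intro A hA
      obtain ⟨hm, hA⟩ := (mem₁ A).1 hA
      obtain ⟨h1, h2⟩ := h𝒜 _ hA
      rw [Finset.card_insert_of_notMem hm] at h2
      refine ⟨fun x hx => ?_, by omega⟩
      have := h1 (Finset.mem_insert_of_mem hx)
      have : x ≠ m := fun h => hm (h ▸ hx)
      simp at *
      omega
    have h0 : 𝒜₀.card + (m - k - 1).choose (k - 1) ≤ (m - 1).choose (k - 1) + 1 := by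
      apply ih k 𝒜₀ hk hn
      · intro A hA
        obtain ⟨hA, hm⟩ := Finset.mem_filter.1 hA
        refine ⟨fun x hx => ?_, (h𝒜 A hA).2⟩
        have := (h𝒜 A hA).1 hx
        have : x ≠ m := fun h => hm (h ▸ hx)
        simp at *
        omega
      · exact hint.mono (Finset.coe_subset.2 (Finset.filter_subset _ _))
      · intro A hA i j hij hj hi
        obtain ⟨hA, hm⟩ := Finset.mem_filter.1 hA
        refine Finset.mem_filter.2 ⟨hsh A hA i j hij hj hi, ?_⟩
        have := Finset.mem_range.1 ((h𝒜 A hA).1 hj)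
        grind
      · refine Finset.mem_filter.2 ⟨hIcc, ?_⟩
        simp
        omega
    have hint₁ : (𝒜₁ : Set (Finset ℕ)).Intersecting := by
      intro A hA B hB hAB
      rw [Finset.mem_coe] at hA hB
      have hA' := sub₁ A hA
      have hB' := sub₁ B hB
      obtain ⟨hmA, hA⟩ := (mem₁ A).1 hA
      obtain ⟨hmB, hB⟩ := (mem₁ B).1 hB
      -- Disjoint `A`, `B` in the link cover only `2 * k - 2 < m` points; shifting `m` to a free
      -- point in one of the two sets makes the original members disjoint.
      have : ∃ i ∈ Finset.range m, i ∉ A ∪ B := by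
        by_contra! hcon
        have h1 := Finset.card_le_card (show Finset.range m ⊆ A ∪ B from hcon)
        have h2 := Finset.card_union_le A B
        rw [Finset.card_range] at h1
        omega
      obtain ⟨i, him, hi⟩ := this
      have him := Finset.mem_range.1 him
      have := hsh _ hA i m him (by simp) (by grind)
      apply hint this hB
      rw [Finset.erase_insert hmA, Finset.disjoint_left]
      rw [Finset.disjoint_left] at hAB
      intro x hx hx'
      simp at *
      rcases hx with rfl | hx
      · rcases hx' with rfl | hx'
        · omega
        · tauto
      · rcases hx' with rfl | hx'
        · tauto
        · exact hAB hx hx'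
    have hsh₁ : IsLeftShifted 𝒜₁ := by
      intro A hA i j hij hj hi
      have hj' := (sub₁ A hA).1 hj
      obtain ⟨hmA, hA⟩ := (mem₁ A).1 hA
      have hj' := Finset.mem_range.1 hj'
      refine (mem₁ _).2 ⟨by simp; exact ⟨by omega, fun _ => hmA⟩, ?_⟩
      have := hsh _ hA i j hij (by simp [hj]) (by simp [hi]; omega)
      rwa [Finset.erase_insert_of_ne (by omega), Finset.insert_comm] at this
    have h1 : 𝒜₁.card + (m - k - 1).choose (k - 2) ≤ (m - 1).choose (k - 2) := by
      by_cases hstar : ∀ A ∈ 𝒜₁, 0 ∈ A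
      · have := card_add_choose_of_star 𝒜₁ (Finset.range m) (Finset.Icc 1 k) 0 (k - 1)
          (by simp; omega) (fun x hx => by simp at *; omega) (by simp) ?_
        · simpa [Nat.sub_sub, add_comm] using this
        · intro A hA
          refine ⟨(sub₁ A hA).1, (sub₁ A hA).2, hstar A hA, fun hd => ?_⟩
          refine hint ((mem₁ A).1 hA).2 hIcc ?_
          rw [Finset.disjoint_insert_left]
          exact ⟨by simp; omega, hd⟩
      · push Not at hstar
        obtain ⟨A, hA, hA0⟩ := hstar
        -- For `k = 2` the link consists of singletons, and a nonzero one would shift to the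
        -- disjoint `{0}`.
        have hk2 : k ≠ 2 := by
          rintro rfl
          obtain ⟨a, rfl⟩ := Finset.card_eq_one.1 (sub₁ A hA).2
          simp at hA0
          have := hsh₁ _ hA 0 a (by omega) (by simp) (by simpa using hA0)
          exact hint₁ hA this (by simp; omega)
        have := ih (k - 1) 𝒜₁ (by omega) (by omega) sub₁ hint₁ hsh₁
          (hsh₁.Icc_mem hA (sub₁ A hA).2 hA0)
        have e : m - (k - 1) - 1 = (m - k - 1) + 1 := by omega
        obtain ⟨l, rfl⟩ : ∃ l, k = l + 3 := ⟨k - 3, by omega⟩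
        have e1 : l + 3 - 1 - 1 = l + 1 := by omega
        have e2 : l + 3 - 2 = l + 1 := by omega
        rw [e, e1, Nat.choose_succ_succ'] at this
        -- Lowering `k` enlarges the subtracted binomial by this positive term, which absorbs the
        -- unwanted `+ 1`.
        have := Nat.choose_pos (show l ≤ m - (l + 3) - 1 by omega)
        rw [e2]
        omega
    obtain ⟨l, rfl⟩ : ∃ l, k = l + 2 := ⟨k - 2, by omega⟩
    obtain ⟨p, rfl⟩ : ∃ p, m = p + (l + 2) + 1 := ⟨m - (l + 2) - 1, by omega⟩
    have e1 : p + (l + 2) + 1 + 1 - (l + 2) - 1 = p + 1 := by omega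
    have e2 : p + (l + 2) + 1 - (l + 2) - 1 = p := by omega
    have e3 : p + (l + 2) + 1 + 1 - 1 = (p + (l + 2)) + 1 := by omega
    have e4 : l + 2 - 1 = l + 1 := by omega
    have e5 : l + 2 - 2 = l := by omega
    have e6 : p + (l + 2) + 1 - 1 = p + (l + 2) := by omega
    rw [e2, e4, e6] at h0
    rw [e2, e5, e6] at h1
    rw [e1, e3, e4, Nat.choose_succ_succ', Nat.choose_succ_succ' (p + (l + 2)), hcard]
    omega

/-! ### Compressions replacing one point by another -/

section Compression

variable {α : Type*} [DecidableEq α]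

theorem compress_singleton_eq {i j : α} (hij : i ≠ j) (A : Finset α) :
    UV.compress {i} {j} A = if i ∉ A ∧ j ∈ A then insert i (A.erase j) else A := by
  unfold UV.compress
  simp only [Finset.disjoint_singleton_left, Finset.singleton_subset_iff]
  split_ifs with h
  · ext x
    simp
    grind
  · rfl

theorem insert_erase_mem_of_compression_eq {𝒜 : Finset (Finset α)} {i j : α} (hij : i ≠ j)
    (h : UV.compression {i} {j} 𝒜 = 𝒜) {A : Finset α} (hA : A ∈ 𝒜) (hi : i ∉ A) (hj : j ∈ A) :
    insert i (A.erase j) ∈ 𝒜 := by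
  have := UV.compress_mem_compression (u := {i}) (v := {j}) hA
  rwa [h, compress_singleton_eq hij, if_pos ⟨hi, hj⟩] at this

theorem mem_compression_singleton {𝒜 : Finset (Finset α)} {i j : α} (hij : i ≠ j) {A : Finset α}
    (hA : A ∈ UV.compression {i} {j} 𝒜) :
    (A ∈ 𝒜 ∧ (i ∉ A → j ∈ A → insert i (A.erase j) ∈ 𝒜)) ∨
      (i ∈ A ∧ j ∉ A ∧ insert j (A.erase i) ∈ 𝒜) := by
  rw [UV.mem_compression] at hA
  rcases hA with ⟨h1, h2⟩ | ⟨h1, B, hB, rfl⟩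
  · left
    refine ⟨h1, fun hi hj => ?_⟩
    rwa [compress_singleton_eq hij, if_pos ⟨hi, hj⟩] at h2
  · right
    rw [compress_singleton_eq hij] at h1 ⊢
    split_ifs at h1 ⊢ with h
    · refine ⟨by simp, by simp [hij.symm], ?_⟩
      rw [Finset.erase_insert (by simp [h.1]), Finset.insert_erase h.2]
      exact hB
    · exact absurd hB h1

/-- Two unmoved members met already, and two moved ones share `i`. For an unmoved `A` and a moved
`B`, undo the move of `B` and, if `j ∈ A`, replace `A` by its shift, which is also in `𝒜`:
disjointness of `A` and `B` would pass to these two members of `𝒜`. -/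
theorem intersecting_compression {𝒜 : Finset (Finset α)} {i j : α} (hij : i ≠ j)
    (h : (𝒜 : Set (Finset α)).Intersecting) :
    (UV.compression {i} {j} 𝒜 : Set (Finset α)).Intersecting := by
  have key : ∀ A B : Finset α, A ∈ 𝒜 → (i ∉ A → j ∈ A → insert i (A.erase j) ∈ 𝒜) →
      i ∈ B → j ∉ B → insert j (B.erase i) ∈ 𝒜 → ¬ Disjoint A B := by
    intro A B hA hA' hi hj hB hd
    have hiA : i ∉ A := fun hiA => Finset.disjoint_left.1 hd hiA hi
    by_cases hjA : j ∈ A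
    · refine h (hA' hiA hjA) hB (Finset.disjoint_left.2 fun x hx hx' => ?_)
      have : x ∈ A → x ∉ B := fun h => Finset.disjoint_left.1 hd h
      grind
    · refine h hA hB (Finset.disjoint_left.2 fun x hx hx' => ?_)
      have : x ∈ A → x ∉ B := fun h => Finset.disjoint_left.1 hd h
      grind
  intro A hA B hB
  rcases mem_compression_singleton hij hA with ⟨h1, h2⟩ | ⟨h1, h2, h3⟩ <;>
    rcases mem_compression_singleton hij hB with ⟨h4, h5⟩ | ⟨h4, h5, h6⟩
  · exact h h1 h4
  · exact key A B h1 h2 h4 h5 h6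
  · exact fun hd => key B A h4 h5 h1 h2 h3 hd.symm
  · exact fun hd => Finset.disjoint_left.1 hd h1 h4

/-- If a family has no common element but its compression does, every member meets the compressed
pair. -/
theorem mem_or_mem_of_compression_star {𝒜 : Finset (Finset α)} {i j x : α} (hij : i ≠ j)
    (hnt : ∀ x, ∃ A ∈ 𝒜, x ∉ A) (hx : ∀ A ∈ UV.compression {i} {j} 𝒜, x ∈ A) :
    ∀ A ∈ 𝒜, i ∈ A ∨ j ∈ A := by
  -- Compression can introduce `x` only if `x = i`. Some member misses `x`, so this does occur.
  have key : ∀ A ∈ 𝒜, x ∈ A ∨ (x = i ∧ j ∈ A) := by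
    intro A hA
    have := hx _ (UV.compress_mem_compression hA)
    rw [compress_singleton_eq hij] at this
    split_ifs at this <;> grind
  obtain ⟨B, hB, hxB⟩ := hnt x
  have hxi := ((key B hB).resolve_left hxB).1
  intro A hA
  have := key A hA
  grind

/-- Every set that moves trades `w j` for the smaller `w i`. The total weight is the termination
measure for shifting. -/
theorem sum_compression_lt {𝒜 : Finset (Finset α)} (w : α → ℕ) {i j : α} (hij : w i < w j)
    (h : UV.compression {i} {j} 𝒜 ≠ 𝒜) :
    ∑ A ∈ UV.compression {i} {j} 𝒜, ∑ a ∈ A, w a < ∑ A ∈ 𝒜, ∑ a ∈ A, w a := by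
  have hne : i ≠ j := by rintro rfl; exact lt_irrefl _ hij
  have e : UV.compression {i} {j} 𝒜 = {A ∈ 𝒜 | UV.compress {i} {j} A ∈ 𝒜} ∪
      {A ∈ 𝒜 | UV.compress {i} {j} A ∉ 𝒜}.image (UV.compress {i} {j}) := by
    rw [UV.compression, Finset.filter_image]
  have hd := UV.compress_disjoint (u := {i}) (v := {j}) (s := 𝒜)
  rw [Finset.filter_image] at hd
  have e2 : ∑ A ∈ 𝒜, ∑ a ∈ A, w a = ∑ A ∈ 𝒜 with UV.compress {i} {j} A ∈ 𝒜, ∑ a ∈ A, w a +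
      ∑ A ∈ 𝒜 with UV.compress {i} {j} A ∉ 𝒜, ∑ a ∈ A, w a :=
    (Finset.sum_filter_add_sum_filter_not _ _ _).symm
  rw [e2, e, Finset.sum_union hd, Finset.sum_image UV.compress_injOn]
  gcongr 1
  apply Finset.sum_lt_sum_of_nonempty
  · by_contra hemp
    rw [Finset.not_nonempty_iff_eq_empty] at hemp
    apply h
    rw [e, hemp, Finset.image_empty, Finset.union_empty, Finset.filter_eq_self]
    intro A hA
    by_contra hA'
    have : A ∈ ({A ∈ 𝒜 | UV.compress {i} {j} A ∉ 𝒜} : Finset (Finset α)) :=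
      Finset.mem_filter.2 ⟨hA, hA'⟩
    rw [hemp] at this
    simp at this
  · intro A hA
    obtain ⟨hA, hA'⟩ := Finset.mem_filter.1 hA
    rw [compress_singleton_eq hne] at hA' ⊢
    split_ifs at hA' ⊢ with hc
    · rw [Finset.sum_insert (by simp [hc.1]), ← Finset.add_sum_erase A w hc.2]
      omega
    · exact absurd hA hA'

end Compression

/-! ### Reduction of Hilton–Milner to left-shifted families -/

/-- Passing to `ℕ` lets the ground set shrink in the induction without changing the type. -/
theorem hilton_milner_of_compressed {n k : ℕ} (hk : 2 ≤ k) (hn : 2 * k ≤ n)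
    (𝒜 : Finset (Finset (Fin n))) (hint : (𝒜 : Set (Finset (Fin n))).Intersecting)
    (hsz : (𝒜 : Set (Finset (Fin n))).Sized k)
    (hc : ∀ i j : Fin n, i < j → UV.compression {i} {j} 𝒜 = 𝒜)
    (h0 : ∃ A ∈ 𝒜, ∀ a ∈ A, a.val ≠ 0) :
    𝒜.card + (n - k - 1).choose (k - 1) ≤ (n - 1).choose (k - 1) + 1 := by
  set ℬ : Finset (Finset ℕ) := 𝒜.image (fun A => A.map Fin.valEmbedding) with hℬ
  have hcard : ℬ.card = 𝒜.card :=
    Finset.card_image_of_injective _ (Finset.map_injective Fin.valEmbedding)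
  have memℬ : ∀ A ∈ 𝒜, A.map Fin.valEmbedding ∈ ℬ := fun A hA => Finset.mem_image_of_mem _ hA
  have hsh : IsLeftShifted ℬ := by
    intro B hB i j hij hj hi
    obtain ⟨A, hA, rfl⟩ := Finset.mem_image.1 hB
    obtain ⟨j, hjA, rfl⟩ := Finset.mem_map.1 hj
    have hin : i < n := hij.trans j.2
    have hi' : (⟨i, hin⟩ : Fin n) ∉ A := fun h => hi (Finset.mem_map.2 ⟨_, h, rfl⟩)
    have hij' : (⟨i, hin⟩ : Fin n) < j := hij
    have := memℬ _ (insert_erase_mem_of_compression_eq hij'.ne (hc _ _ hij') hA hi' hjA)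
    rwa [Finset.map_insert, Finset.map_erase] at this
  rw [← hcard]
  apply IsLeftShifted.card_add_choose_le n k ℬ hk hn _ _ hsh
  · obtain ⟨A, hA, hA0⟩ := h0
    refine hsh.Icc_mem (memℬ A hA) (by rw [Finset.card_map]; exact hsz hA) ?_
    intro h
    obtain ⟨a, ha, ha0⟩ := Finset.mem_map.1 h
    exact hA0 a ha ha0
  · intro B hB
    obtain ⟨A, hA, rfl⟩ := Finset.mem_image.1 hB
    refine ⟨fun x hx => ?_, by rw [Finset.card_map]; exact hsz hA⟩
    obtain ⟨a, ha, rfl⟩ := Finset.mem_map.1 hx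
    simp
  · intro B hB B' hB' hd
    obtain ⟨A, hA, rfl⟩ := Finset.mem_image.1 hB
    obtain ⟨A', hA', rfl⟩ := Finset.mem_image.1 hB'
    exact hint hA hA' ((Finset.disjoint_map _).1 hd)

/-- The Hilton–Milner bound for families containing all `k`-subsets of the first `k + 1` points. -/
theorem hilton_milner_of_clique_initial {n k : ℕ} (hk : 2 ≤ k) (hn : 2 * k ≤ n)
    (𝒜 : Finset (Finset (Fin n))) (hint : (𝒜 : Set (Finset (Fin n))).Intersecting)
    (hsz : (𝒜 : Set (Finset (Fin n))).Sized k)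
    (hcl : ∀ A : Finset (Fin n), A.card = k → (∀ a ∈ A, a.val ≤ k) → A ∈ 𝒜) :
    𝒜.card + (n - k - 1).choose (k - 1) ≤ (n - 1).choose (k - 1) + 1 := by
  induction hw : ∑ A ∈ 𝒜, ∑ a ∈ A, a.val using Nat.strong_induction_on generalizing 𝒜 with
  | _ m ih =>
    by_cases hc : ∀ i j : Fin n, i < j → UV.compression {i} {j} 𝒜 = 𝒜
    · refine hilton_milner_of_compressed hk hn 𝒜 hint hsz hc ?_
      have hinj : Function.Injective (fun i : Fin k => (⟨i.val + 1, by omega⟩ : Fin n)) := by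
        intro a b h
        simp at h
        omega
      refine ⟨Finset.univ.map ⟨_, hinj⟩, hcl _ (by simp) ?_, ?_⟩
      · intro a ha
        simp at ha
        obtain ⟨b, rfl⟩ := ha
        simp
      · intro a ha
        simp at ha
        obtain ⟨b, rfl⟩ := ha
        simp
    -- A left shift of a subset of the first `k + 1` points stays among them, so the clique survives
    -- compression; it guarantees a member avoiding `0` when the process stops.
    · push Not at hc
      obtain ⟨i, j, hij, hc⟩ := hc
      have := ih _ (by rw [← hw]; exact sum_compression_lt (fun a : Fin n => a.val) hij hc)
        (UV.compression {i} {j} 𝒜) (intersecting_compression hij.ne hint)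
        (hsz.uvCompression (by simp)) ?_ rfl
      · rwa [UV.card_compression] at this
      · intro A hA hA'
        rw [UV.mem_compression]
        left
        refine ⟨hcl A hA hA', ?_⟩
        rw [compress_singleton_eq hij.ne]
        split_ifs with h
        · refine hcl _ ?_ ?_
          · rw [Finset.card_insert_of_notMem (by simp [h.1]), Finset.card_erase_add_one h.2, hA]
          · intro a ha
            have := hA' j h.2
            have h2 : i.val < j.val := hij
            rcases Finset.mem_insert.1 ha with rfl | ha
            · omega
            · exact hA' a (Finset.mem_of_mem_erase ha)
        · exact hcl A hA hA'

/-- A permutation of the points carries `T` to the first `k + 1` points. -/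
theorem hilton_milner_of_clique {n k : ℕ} (hk : 2 ≤ k) (hn : 2 * k ≤ n)
    (𝒜 : Finset (Finset (Fin n))) (hint : (𝒜 : Set (Finset (Fin n))).Intersecting)
    (hsz : (𝒜 : Set (Finset (Fin n))).Sized k) (T : Finset (Fin n)) (hT : T.card = k + 1)
    (hcl : ∀ A : Finset (Fin n), A.card = k → A ⊆ T → A ∈ 𝒜) :
    𝒜.card + (n - k - 1).choose (k - 1) ≤ (n - 1).choose (k - 1) + 1 := by
  have hcardT : Fintype.card {x // x ∈ T} = Fintype.card {x : Fin n // x.val ≤ k} := by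
    rw [Fintype.card_coe, hT, Fintype.card_subtype]
    have : (Finset.univ.filter fun x : Fin n => x.val ≤ k) = Finset.Iic ⟨k, by omega⟩ := by
      ext x
      simp [Fin.le_def]
    rw [this, Fin.card_Iic]
  obtain ⟨e⟩ := Fintype.card_eq.1 hcardT
  set σ : Equiv.Perm (Fin n) := e.extendSubtype with hσ
  have hσT : ∀ x, (σ x).val ≤ k → x ∈ T := by
    intro x hx
    by_contra hxT
    exact e.extendSubtype_not_mem x hxT hx
  have hcard : (𝒜.image (fun A => A.map σ.toEmbedding)).card = 𝒜.card :=
    Finset.card_image_of_injective _ (Finset.map_injective σ.toEmbedding)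
  rw [← hcard]
  apply hilton_milner_of_clique_initial hk hn
  · intro B hB B' hB' hd
    obtain ⟨A, hA, rfl⟩ := Finset.mem_image.1 hB
    obtain ⟨A', hA', rfl⟩ := Finset.mem_image.1 hB'
    exact hint hA hA' ((Finset.disjoint_map _).1 hd)
  · intro B hB
    obtain ⟨A, hA, rfl⟩ := Finset.mem_image.1 hB
    rw [Finset.card_map]
    exact hsz hA
  · intro B hB hB'
    refine Finset.mem_image.2 ⟨B.map σ.symm.toEmbedding, hcl _ (by simpa using hB) ?_, ?_⟩
    · intro x hx
      obtain ⟨b, hb, rfl⟩ := Finset.mem_map.1 hx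
      apply hσT
      simpa using hB' b hb
    · ext x
      simp

theorem exists_initial_subset {n : ℕ} (m : ℕ) (U : Finset (Fin n)) (hm : m ≤ U.card) :
    ∃ M ⊆ U, M.card = m ∧ ∀ i ∈ M, ∀ j ∈ U, j ∉ M → i < j := by
  induction m with
  | zero => exact ⟨∅, by simp⟩
  | succ m ih =>
    obtain ⟨M, hMU, hM, hMi⟩ := ih (by omega)
    have hne : (U \ M).Nonempty := by
      rw [← Finset.card_pos, Finset.card_sdiff_of_subset hMU]
      omega
    have hmin := Finset.min'_mem _ hne
    set a := (U \ M).min' hne with ha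
    obtain ⟨haU, haM⟩ := Finset.mem_sdiff.1 hmin
    refine ⟨insert a M, Finset.insert_subset haU hMU, by rw [Finset.card_insert_of_notMem haM, hM],
      ?_⟩
    intro i hi j hj hjM
    rw [Finset.mem_insert, not_or] at hjM
    rcases Finset.mem_insert.1 hi with rfl | hi
    · exact lt_of_le_of_ne (Finset.min'_le _ _ (Finset.mem_sdiff.2 ⟨hj, hjM.2⟩)) (Ne.symm hjM.1)
    · exact hMi i hi j hj hjM.2

/-- A family with all pairs of points outside `{i, j}` compressed, all members of which meet
`{i, j}`, and which contains all `k`-sets through `i` and `j`, has a `k`-clique on `k + 1`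
points. -/
theorem exists_clique_of_compressed_off_pair {n k : ℕ} (hk : 2 ≤ k) (hn : 2 * k ≤ n)
    (𝒜 : Finset (Finset (Fin n))) (hsz : (𝒜 : Set (Finset (Fin n))).Sized k) (i j : Fin n)
    (hij : i ≠ j) (hnt : ∀ x, ∃ A ∈ 𝒜, x ∉ A) (hmeet : ∀ A ∈ 𝒜, i ∈ A ∨ j ∈ A)
    (hall : ∀ A : Finset (Fin n), A.card = k → i ∈ A → j ∈ A → A ∈ 𝒜)
    (hc : ∀ a b : Fin n, a < b → a ≠ i → a ≠ j → b ≠ i → b ≠ j →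
      UV.compression {a} {b} 𝒜 = 𝒜) :
    ∃ T : Finset (Fin n), T.card = k + 1 ∧ ∀ A : Finset (Fin n), A.card = k → A ⊆ T → A ∈ 𝒜 := by
  set U : Finset (Fin n) := (Finset.univ.erase i).erase j with hU
  have hUcard : U.card = n - 2 := by
    rw [hU, Finset.card_erase_of_mem (by simp [hij.symm]), Finset.card_erase_of_mem (by simp),
      Finset.card_univ, Fintype.card_fin]
    omega
  have memU : ∀ x, x ∈ U ↔ x ≠ j ∧ x ≠ i := by simp [hU]
  obtain ⟨M, hMU, hM, hMi⟩ := exists_initial_subset (k - 1) U (by omega)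
  have hiM : i ∉ M := fun h => ((memU i).1 (hMU h)).2 rfl
  have hjM : j ∉ M := fun h => ((memU j).1 (hMU h)).1 rfl
  -- A member avoiding `q` contains `p`; shifts off the pair push its other `k - 1` points down to
  -- `M`.
  have key : ∀ p q : Fin n, (p = i ∧ q = j ∨ p = j ∧ q = i) → insert p M ∈ 𝒜 := by
    intro p q hpq
    obtain ⟨A, hA, hqA⟩ := hnt q
    have hpA : p ∈ A := by
      have := hmeet A hA
      grind
    refine initial_of_shift_stable (· < ·) (fun X => insert p X ∈ 𝒜) U M hMU hMi ?_ (A.erase p)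
      (by rwa [Finset.insert_erase hpA]) ?_ ?_
    · intro B hB hBU a ha b hb hab haB
      have ha' := (memU a).1 ha
      have hb' := (memU b).1 (hBU hb)
      have := insert_erase_mem_of_compression_eq hab.ne
        (hc a b hab ha'.2 ha'.1 hb'.2 hb'.1) hB (by grind) (by grind)
      rwa [Finset.erase_insert_of_ne (by grind), Finset.insert_comm] at this
    · intro x hx
      rw [memU]
      grind
    · rw [Finset.card_erase_of_mem hpA, hM, hsz hA]
  -- A `k`-subset of this set omits one point: if that is `i` or `j`, use `key`; otherwise use
  -- `hall`.
  refine ⟨insert i (insert j M), ?_, ?_⟩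
  · rw [Finset.card_insert_of_notMem (by grind), Finset.card_insert_of_notMem hjM, hM]
    omega
  · intro A hA hAT
    by_cases hiA : i ∈ A
    · by_cases hjA : j ∈ A
      · exact hall A hA hiA hjA
      · have : A = insert i M := by
          apply Finset.eq_of_subset_of_card_le
          · intro x hx
            have := hAT hx
            grind
          · rw [Finset.card_insert_of_notMem hiM]
            omega
        rw [this]
        exact key i j (by simp)
    · have : A = insert j M := by
        apply Finset.eq_of_subset_of_card_le
        · intro x hx
          have := hAT hx
          grind
        · rw [Finset.card_insert_of_notMem hjM]
          omega
      rw [this]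
      exact key j i (by simp)

/-- The **Hilton–Milner theorem**: an intersecting family of `k`-sets without a common element has
at most `(n-1).choose (k-1) - (n-k-1).choose (k-1) + 1` members. -/
theorem hilton_milner {n k : ℕ} (hk : 2 ≤ k) (hn : 2 * k ≤ n)
    (𝒜 : Finset (Finset (Fin n))) (hint : (𝒜 : Set (Finset (Fin n))).Intersecting)
    (hsz : (𝒜 : Set (Finset (Fin n))).Sized k) (hnt : ∀ x, ∃ A ∈ 𝒜, x ∉ A) :
    𝒜.card + (n - k - 1).choose (k - 1) ≤ (n - 1).choose (k - 1) + 1 := by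
  classical
  set 𝓢 : Finset (Finset (Finset (Fin n))) := Finset.univ.filter fun 𝒜 =>
    (𝒜 : Set (Finset (Fin n))).Intersecting ∧ (𝒜 : Set (Finset (Fin n))).Sized k ∧
      ∀ x, ∃ A ∈ 𝒜, x ∉ A with h𝓢
  have h𝒜 : 𝒜 ∈ 𝓢 := by simpa [h𝓢] using ⟨hint, hsz, hnt⟩
  obtain ⟨ℬ, hℬ, hmax⟩ := Finset.exists_max_image 𝓢 Finset.card ⟨𝒜, h𝒜⟩
  -- Among non-trivial intersecting families of maximum size, take one of least weight. A
  -- compression that changes it must then create a common point.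
  obtain ⟨𝒞, h𝒞, hmin⟩ := Finset.exists_min_image
    (𝓢.filter fun 𝒞 => 𝒞.card = ℬ.card) (fun 𝒞 => ∑ A ∈ 𝒞, ∑ a ∈ A, a.val)
    ⟨ℬ, by simp [hℬ]⟩
  obtain ⟨h𝒞, hcard⟩ := Finset.mem_filter.1 h𝒞
  have hle : 𝒜.card ≤ 𝒞.card := hcard ▸ hmax 𝒜 h𝒜
  obtain ⟨hint', hsz', hnt'⟩ := (Finset.mem_filter.1 h𝒞).2
  refine le_trans (Nat.add_le_add_right hle _) ?_
  have hstep : ∀ i j : Fin n, i < j → UV.compression {i} {j} 𝒞 ≠ 𝒞 →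
      ∀ A ∈ 𝒞, i ∈ A ∨ j ∈ A := by
    intro i j hij hne
    by_cases hnt2 : ∀ x, ∃ A ∈ UV.compression {i} {j} 𝒞, x ∉ A
    · exfalso
      have h1 := sum_compression_lt (fun a : Fin n => a.val) hij hne
      refine absurd (hmin (UV.compression {i} {j} 𝒞) ?_) (not_le.2 h1)
      refine Finset.mem_filter.2 ⟨Finset.mem_filter.2 ⟨Finset.mem_univ _,
        intersecting_compression hij.ne hint', hsz'.uvCompression (by simp), hnt2⟩, ?_⟩
      rw [UV.card_compression, hcard]
    · push Not at hnt2
      obtain ⟨x, hx⟩ := hnt2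
      exact mem_or_mem_of_compression_star hij.ne hnt' hx
  by_cases hc : ∀ i j : Fin n, i < j → UV.compression {i} {j} 𝒞 = 𝒞
  · refine hilton_milner_of_compressed hk hn 𝒞 hint' hsz' hc ?_
    obtain ⟨A, hA, hA0⟩ := hnt' ⟨0, by omega⟩
    exact ⟨A, hA, fun a ha h0 => hA0 (by convert! ha; exact h0.symm)⟩
  push Not at hc
  obtain ⟨i, j, hij, hc⟩ := hc
  have hmeet := hstep i j hij hc
  -- A set through `i` and `j` meets every member, so maximality puts it in `𝒞`.
  have hall : ∀ A : Finset (Fin n), A.card = k → i ∈ A → j ∈ A → A ∈ 𝒞 := by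
    intro A hA hi hj
    by_contra hA𝒞
    have : insert A 𝒞 ∈ 𝓢 := by
      refine Finset.mem_filter.2 ⟨Finset.mem_univ _, ?_, ?_, ?_⟩
      · have hAB : ∀ B ∈ 𝒞, ¬ Disjoint A B := by
          intro B hB hd
          rcases hmeet B hB with h | h
          · exact Finset.disjoint_left.1 hd hi h
          · exact Finset.disjoint_left.1 hd hj h
        intro B hB B' hB'
        rw [Finset.mem_coe, Finset.mem_insert] at hB hB'
        rcases hB with rfl | hB <;> rcases hB' with rfl | hB'
        · exact fun hd => Finset.disjoint_left.1 hd hi hi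
        · exact hAB _ hB'
        · exact fun hd => hAB _ hB hd.symm
        · exact hint' hB hB'
      · intro B hB
        rcases Finset.mem_insert.1 (Finset.mem_coe.1 hB) with rfl | hB
        · exact hA
        · exact hsz' hB
      · intro x
        obtain ⟨B, hB, hx⟩ := hnt' x
        exact ⟨B, Finset.mem_insert_of_mem hB, hx⟩
    have := hmax _ this
    rw [Finset.card_insert_of_notMem hA𝒞] at this
    omega
  obtain ⟨T, hT, hcl⟩ := exists_clique_of_compressed_off_pair hk hn 𝒞 hsz' i j hij.ne hnt' hmeet hall
    (by
      intro a b hab hai haj hbi hbj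
      by_contra hne
      have h2 := hstep a b hab hne
      -- Some `k`-set through `i`, `j` avoids both `a` and `b`. It lies in `𝒞`, contradicting `h2`.
      have hsub : ({i, j} : Finset (Fin n)) ⊆ (Finset.univ.erase a).erase b := by
        intro x hx
        simp at hx ⊢
        grind
      obtain ⟨A, hA1, hA2, hA3⟩ := Finset.exists_subsuperset_card_eq hsub
        (n := k) (by rw [Finset.card_pair hij.ne]; exact hk) (by
          rw [Finset.card_erase_of_mem (by simp [hab.ne']), Finset.card_erase_of_mem (by simp),
            Finset.card_univ, Fintype.card_fin]
          omega)
      have := h2 A (hall A hA3 (hA1 (by simp)) (hA1 (by simp)))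
      rcases this with h | h
      · have := hA2 h
        simp at this
      · have := hA2 h
        simp at this)
  exact hilton_milner_of_clique hk hn 𝒞 hint' hsz' T hT hcl

/-! ### Atoms and connectivity of arc-transitive graphs -/

namespace SimpleGraph

variable {V : Type*} [Fintype V] [DecidableEq V] {G : SimpleGraph V}

open Classical in
/-- The vertices outside `X` with a neighbour in `X`. -/
noncomputable def outerBoundary (G : SimpleGraph V) (X : Finset V) : Finset V :=
  {v | v ∉ X ∧ ∃ x ∈ X, G.Adj x v}

theorem mem_outerBoundary {X : Finset V} {v : V} :
    v ∈ G.outerBoundary X ↔ v ∉ X ∧ ∃ x ∈ X, G.Adj x v := by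
  simp [outerBoundary]

theorem card_outerBoundary_map (g : G ≃g G) (X : Finset V) :
    (G.outerBoundary (X.map g.toEquiv.toEmbedding)).card = (G.outerBoundary X).card := by
  rw [← Finset.card_map g.toEquiv.toEmbedding (s := G.outerBoundary X)]
  congr 1
  ext v
  rw [Finset.mem_map_equiv, mem_outerBoundary, mem_outerBoundary, Finset.mem_map_equiv]
  refine and_congr_right fun _ => ⟨?_, ?_⟩
  · rintro ⟨x, hx, hxv⟩
    exact ⟨g.symm x, (Finset.mem_map_equiv (f := g.toEquiv)).1 hx, g.symm.map_adj_iff.2 hxv⟩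
  · rintro ⟨x, hx, hxv⟩
    refine ⟨g x, Finset.mem_map_of_mem _ hx, ?_⟩
    have := g.map_adj_iff.2 hxv
    rwa [show g (g.toEquiv.symm v) = v from g.toEquiv.apply_symm_apply v] at this

/-- Submodularity: the union of the two boundaries on the left lies in the union of those on the
right, and likewise for the intersections. -/
theorem card_outerBoundary_inter_add_union_le (X Z : Finset V) :
    (G.outerBoundary (X ∩ Z)).card + (G.outerBoundary (X ∪ Z)).card ≤
      (G.outerBoundary X).card + (G.outerBoundary Z).card := by
  rw [← Finset.card_union_add_card_inter, ← Finset.card_union_add_card_inter (G.outerBoundary X)]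
  apply Nat.add_le_add
  · apply Finset.card_le_card
    intro v
    simp only [Finset.mem_union, mem_outerBoundary, Finset.mem_inter]
    grind
  · apply Finset.card_le_card
    intro v
    simp only [Finset.mem_union, mem_outerBoundary, Finset.mem_inter]
    grind

/-- In a connected arc-transitive graph, a proper block of imprimitivity is independent. -/
theorem not_adj_of_block
    (harc : ∀ x y z, G.Adj x y → G.Adj x z → ∃ g : G ≃g G, g x = x ∧ g y = z)
    (hconn : ∀ U : Finset V, U.Nonempty → (∀ x ∈ U, ∀ y, G.Adj x y → y ∈ U) → U = Finset.univ)
    (X : Finset V) (hX : X ≠ Finset.univ)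
    (hblock : ∀ g : G ≃g G, (X ∩ X.map g.toEquiv.toEmbedding).Nonempty →
      X.map g.toEquiv.toEmbedding = X) :
    ∀ x ∈ X, ∀ y ∈ X, ¬ G.Adj x y := by
  classical
  intro x hx y hy hxy
  apply hX
  -- This set is closed under adjacency: an automorphism fixing `u` and carrying a neighbour `v ∈ X`
  -- to any neighbour `z` preserves the block, so `z ∈ X`.
  have : X.filter (fun u => ∃ v ∈ X, G.Adj u v) = Finset.univ := by
    refine hconn _ ⟨x, by simp; exact ⟨hx, y, hy, hxy⟩⟩ ?_
    intro u hu z huz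
    obtain ⟨hu, v, hv, huv⟩ := Finset.mem_filter.1 hu
    obtain ⟨g, hgu, hgv⟩ := harc u v z huv huz
    have hgX := hblock g ⟨u, Finset.mem_inter.2 ⟨hu, Finset.mem_map.2 ⟨u, hu, hgu⟩⟩⟩
    refine Finset.mem_filter.2 ⟨?_, u, hu, huz.symm⟩
    rw [← hgX]
    exact Finset.mem_map.2 ⟨v, hv, hgv⟩
  rw [Finset.eq_univ_iff_forall] at this ⊢
  exact fun v => (Finset.mem_filter.1 (this v)).1

/-- A connected arc-transitive graph of degree `d` is `d`-connected. -/
theorem le_card_outerBoundary (d : ℕ) (hdeg : ∀ v, (G.outerBoundary {v}).card = d)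
    (harc : ∀ x y z, G.Adj x y → G.Adj x z → ∃ g : G ≃g G, g x = x ∧ g y = z)
    (hconn : ∀ U : Finset V, U.Nonempty → (∀ x ∈ U, ∀ y, G.Adj x y → y ∈ U) → U = Finset.univ)
    (X : Finset V) (hX : X.Nonempty) (hX' : X ∪ G.outerBoundary X ≠ Finset.univ) :
    d ≤ (G.outerBoundary X).card := by
  classical
  set 𝓢 : Finset (Finset V) :=
    {X | X.Nonempty ∧ X ∪ G.outerBoundary X ≠ Finset.univ} with h𝓢
  have mem𝓢 : ∀ Y, Y ∈ 𝓢 ↔ Y.Nonempty ∧ Y ∪ G.outerBoundary Y ≠ Finset.univ := by simp [h𝓢]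
  obtain ⟨X₀, hX₀, hmin₀⟩ := Finset.exists_min_image 𝓢 (fun X => (G.outerBoundary X).card)
    ⟨X, (mem𝓢 X).2 ⟨hX, hX'⟩⟩
  -- `A` is an atom: least boundary first, then least size. Submodularity makes it a block, hence
  -- independent, so its boundary contains the whole neighbourhood of any of its vertices.
  obtain ⟨A, hA, hmin⟩ := Finset.exists_min_image
    (𝓢.filter fun Y => (G.outerBoundary Y).card = (G.outerBoundary X₀).card) Finset.card
    ⟨X₀, by simp [hX₀]⟩
  obtain ⟨hA𝓢, hAcard⟩ := Finset.mem_filter.1 hA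
  have hκ : ∀ Y ∈ 𝓢, (G.outerBoundary A).card ≤ (G.outerBoundary Y).card :=
    fun Y hY => hAcard ▸ hmin₀ Y hY
  have hmin' : ∀ Y ∈ 𝓢, (G.outerBoundary Y).card ≤ (G.outerBoundary A).card →
      A.card ≤ Y.card := fun Y hY h =>
    hmin Y (Finset.mem_filter.2 ⟨hY, le_antisymm (hAcard ▸ h) (hmin₀ Y hY)⟩)
  refine le_trans ?_ (hκ X ((mem𝓢 X).2 ⟨hX, hX'⟩))
  obtain ⟨hAne, hAuniv⟩ := (mem𝓢 A).1 hA𝓢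
  -- the rest is at least as large as the atom
  have hrest : A.card ≤ (Finset.univ \ (A ∪ G.outerBoundary A)).card := by
    have hsub : G.outerBoundary (Finset.univ \ (A ∪ G.outerBoundary A)) ⊆ G.outerBoundary A := by
      intro v hv
      obtain ⟨hv, x, hx, hxv⟩ := mem_outerBoundary.1 hv
      simp only [Finset.mem_sdiff, Finset.mem_univ, true_and, not_not, Finset.mem_union] at hv
      simp only [Finset.mem_sdiff, Finset.mem_univ, true_and, Finset.mem_union, not_or] at hx
      refine hv.resolve_left fun hvA => hx.2 (mem_outerBoundary.2 ⟨hx.1, v, hvA, hxv.symm⟩)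
    apply hmin' _ _ (Finset.card_le_card hsub)
    rw [mem𝓢]
    constructor
    · rw [Finset.sdiff_nonempty]
      exact fun h => hAuniv (Finset.univ_subset_iff.1 h)
    · obtain ⟨a, ha⟩ := hAne
      intro h
      have := h ▸ Finset.mem_univ a
      rcases Finset.mem_union.1 this with h | h
      · exact (Finset.mem_sdiff.1 h).2 (Finset.mem_union_left _ ha)
      · exact (mem_outerBoundary.1 (hsub h)).1 ha
  have hV : A.card + (G.outerBoundary A).card +
      (Finset.univ \ (A ∪ G.outerBoundary A)).card = Fintype.card V := by
    rw [← Finset.card_union_of_disjoint, ← Finset.card_union_of_disjoint,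
      Finset.union_sdiff_of_subset (Finset.subset_univ _), Finset.card_univ]
    · exact Finset.disjoint_sdiff
    · rw [Finset.disjoint_left]
      exact fun v hv hv' => (mem_outerBoundary.1 hv').1 hv
  have hblock : ∀ g : G ≃g G, (A ∩ A.map g.toEquiv.toEmbedding).Nonempty →
      A.map g.toEquiv.toEmbedding = A := by
    intro g hne
    set Z := A.map g.toEquiv.toEmbedding with hZ
    have hZcard : Z.card = A.card := Finset.card_map _
    have hZb : (G.outerBoundary Z).card = (G.outerBoundary A).card := card_outerBoundary_map g A
    have hsubm := card_outerBoundary_inter_add_union_le (G := G) A Z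
    have hinter : A ∩ Z ∈ 𝓢 := by
      refine (mem𝓢 _).2 ⟨hne, fun h => hAuniv ?_⟩
      rw [Finset.eq_univ_iff_forall] at h ⊢
      intro v
      have := h v
      simp only [Finset.mem_union, Finset.mem_inter, mem_outerBoundary] at this ⊢
      grind
    have h1 := hκ _ hinter
    by_cases hun : A ∪ Z ∪ G.outerBoundary (A ∪ Z) = Finset.univ
    -- Here submodularity gives `|V| ≤ |A ∪ Z| + |∂A| < 2|A| + |∂A|`, against `hrest` and `hV`.
    · exfalso
      have h2 : Fintype.card V ≤ (A ∪ Z).card + (G.outerBoundary (A ∪ Z)).card := by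
        rw [← Finset.card_univ, ← hun]
        exact Finset.card_union_le _ _
      have h3 := Finset.card_union_add_card_inter A Z
      have h4 := Finset.card_pos.2 hne
      omega
    · have h2 := hκ (A ∪ Z) ((mem𝓢 _).2 ⟨hAne.mono Finset.subset_union_left, hun⟩)
      have h3 := hmin' _ hinter (by omega)
      have h4 : A ∩ Z = A := Finset.eq_of_subset_of_card_le Finset.inter_subset_left h3
      exact (Finset.eq_of_subset_of_card_le (Finset.inter_eq_left.1 h4) hZcard.le).symm
  have hindep := not_adj_of_block harc hconn A (by rintro rfl; simp at hAuniv) hblock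
  obtain ⟨a, ha⟩ := hAne
  rw [← hdeg a]
  apply Finset.card_le_card
  intro v hv
  obtain ⟨hv, x, hx, hxv⟩ := mem_outerBoundary.1 hv
  rw [Finset.mem_singleton] at hx
  subst hx
  exact mem_outerBoundary.2 ⟨fun hvA => hindep _ ha _ hvA hxv, _, ha, hxv⟩

/-! ### Components left by a minimum cut -/

/-- `C` lists the vertex sets of the components of the graph `G` with `S` deleted. -/
structure IsShattering (G : SimpleGraph V) (S : Finset V) {ι : Type*} (C : ι → Finset V) :
    Prop where
  nonempty : ∀ i, (C i).Nonempty
  eq_of_mem : ∀ i j v, v ∈ C i → v ∈ C j → i = j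
  notMem : ∀ i, ∀ v ∈ C i, v ∉ S
  exists_mem : ∀ v, v ∉ S → ∃ i, v ∈ C i
  mem_of_adj : ∀ i, ∀ v ∈ C i, ∀ w, w ∉ S → G.Adj v w → w ∈ C i
  subset_of_closed : ∀ i, ∀ Y : Finset V, (C i ∩ Y).Nonempty →
    (∀ v ∈ C i, ∀ w ∈ C i, G.Adj v w → v ∈ Y → w ∈ Y) → C i ⊆ Y

namespace IsShattering

variable {S T : Finset V} {ι : Type*} {C D : ι → Finset V}

omit [Fintype V] in
theorem map (h : G.IsShattering S C) (g : G ≃g G) :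
    G.IsShattering (S.map g.toEquiv.toEmbedding) (fun i => (C i).map g.toEquiv.toEmbedding) where
  nonempty i := (h.nonempty i).map
  eq_of_mem i j v hi hj := by
    rw [Finset.mem_map_equiv] at hi hj
    exact h.eq_of_mem i j _ hi hj
  notMem i v hi := by
    rw [Finset.mem_map_equiv] at hi ⊢
    exact h.notMem i _ hi
  exists_mem v hv := by
    simp only [Finset.mem_map_equiv] at hv ⊢
    exact h.exists_mem _ hv
  mem_of_adj i v hv w hw hvw := by
    simp only [Finset.mem_map_equiv] at *
    exact h.mem_of_adj i _ hv _ hw (g.symm.map_adj_iff.2 hvw)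
  subset_of_closed i Y hY hcl := by
    have := h.subset_of_closed i (Y.map g.symm.toEquiv.toEmbedding) ?_ ?_
    · intro v hv
      rw [Finset.mem_map_equiv] at hv
      have := this hv
      rw [Finset.mem_map_equiv] at this
      rwa [show g.symm.toEquiv.symm (g.toEquiv.symm v) = v from
        g.toEquiv.apply_symm_apply v] at this
    · obtain ⟨y, hy⟩ := hY
      obtain ⟨hy1, hy2⟩ := Finset.mem_inter.1 hy
      obtain ⟨x, hx, rfl⟩ := Finset.mem_map.1 hy1
      refine ⟨x, Finset.mem_inter.2 ⟨hx, ?_⟩⟩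
      rw [Finset.mem_map_equiv]
      exact hy2
    · intro v hv w hw hvw hvY
      rw [Finset.mem_map_equiv] at hvY ⊢
      exact hcl _ (Finset.mem_map_of_mem _ hv) _ (Finset.mem_map_of_mem _ hw)
        (g.map_adj_iff.2 hvw) hvY

theorem outerBoundary_subset (h : G.IsShattering S C) (i : ι) :
    G.outerBoundary (C i) ⊆ S := by
  intro v hv
  obtain ⟨hv, x, hx, hxv⟩ := mem_outerBoundary.1 hv
  by_contra hvS
  exact hv (h.mem_of_adj i x hx v hvS hxv)

theorem inter_union_outerBoundary_ne_univ (h : G.IsShattering S C) {i j : ι} (hij : i ≠ j)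
    {X : Finset V} (hX : X ⊆ C i) : X ∪ G.outerBoundary X ≠ Finset.univ := by
  obtain ⟨v, hv⟩ := h.nonempty j
  intro hun
  rcases Finset.mem_union.1 (hun ▸ Finset.mem_univ v) with hvX | hvX
  · exact hij (h.eq_of_mem i j v (hX hvX) hv)
  · obtain ⟨-, x, hx, hxv⟩ := mem_outerBoundary.1 hvX
    exact hij (h.eq_of_mem i j v (h.mem_of_adj i x (hX hx) v (h.notMem j v hv) hxv) hv)

omit [Fintype V] in
-- A component untouched by `T` remains connected after `T` is deleted.
theorem subset_of_disjoint (h : G.IsShattering S C) (h' : G.IsShattering T D) {i j : ι}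
    (hT : T ∩ C i = ∅) (hne : (C i ∩ D j).Nonempty) : C i ⊆ D j := by
  refine h.subset_of_closed i (D j) hne fun v _ w hw hvw hvD =>
    h'.mem_of_adj j v hvD w (fun hwT => ?_) hvw
  have := Finset.mem_inter.2 ⟨hwT, hw⟩
  simp [hT] at this

/-- An edge leaving the corner exits `C i` through `S` or `D j` through `T`. -/
theorem card_corner (h : G.IsShattering S C) (h' : G.IsShattering T D) (i j : ι) :
    (G.outerBoundary (C i ∩ D j)).card ≤ (S ∩ D j).card + (T ∩ C i).card + (S ∩ T).card := by
  refine le_trans (Finset.card_le_card ?_) ((Finset.card_union_le _ _).trans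
    (Nat.add_le_add_right (Finset.card_union_le _ _) _))
  intro v hv
  obtain ⟨hv, x, hx, hxv⟩ := mem_outerBoundary.1 hv
  obtain ⟨hxC, hxD⟩ := Finset.mem_inter.1 hx
  have h1 := h.mem_of_adj i x hxC v
  have h2 := h'.mem_of_adj j x hxD v
  simp only [Finset.mem_union, Finset.mem_inter] at hv ⊢
  tauto

omit [Fintype V] in
theorem card_inter_add_le (h' : G.IsShattering T D) {i j : ι} (hij : i ≠ j) (S : Finset V) :
    (S ∩ D i).card + (S ∩ D j).card + (S ∩ T).card ≤ S.card := by
  rw [← Finset.card_union_of_disjoint, ← Finset.card_union_of_disjoint]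
  · apply Finset.card_le_card
    grind
  · rw [Finset.disjoint_left]
    intro v hv hv'
    have h1 := h'.notMem i v
    have h2 := h'.notMem j v
    grind
  · rw [Finset.disjoint_left]
    intro v hv hv'
    exact hij (h'.eq_of_mem i j v (Finset.mem_inter.1 hv).2 (Finset.mem_inter.1 hv').2)

omit [Fintype V] in
theorem card_inter_add_add_le (h' : G.IsShattering T D) {i j l : ι} (hij : i ≠ j) (hil : i ≠ l)
    (hjl : j ≠ l) (S : Finset V) :
    (S ∩ D i).card + (S ∩ D j).card + (S ∩ D l).card + (S ∩ T).card ≤ S.card := by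
  rw [← Finset.card_union_of_disjoint, ← Finset.card_union_of_disjoint,
    ← Finset.card_union_of_disjoint]
  · apply Finset.card_le_card
    grind
  · rw [Finset.disjoint_left]
    intro v hv hv'
    have h1 := h'.notMem i v
    have h2 := h'.notMem j v
    have h3 := h'.notMem l v
    grind
  · rw [Finset.disjoint_left]
    intro v hv hv'
    have h1 := h'.eq_of_mem i l v
    have h2 := h'.eq_of_mem j l v
    grind
  · rw [Finset.disjoint_left]
    intro v hv hv'
    exact hij (h'.eq_of_mem i j v (Finset.mem_inter.1 hv).2 (Finset.mem_inter.1 hv').2)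

/-- If every boundary has size at least `d` and the removal of a set `S` of size `d` leaves at
least three components, then a component that is not larger than any other, with one exception,
is a block of imprimitivity. -/
theorem map_eq_of_inter_nonempty (h : G.IsShattering S C) (d : ℕ)
    (hκ : ∀ X : Finset V, X.Nonempty → X ∪ G.outerBoundary X ≠ Finset.univ →
      d ≤ (G.outerBoundary X).card) (hS : S.card = d) (hthree : ∀ i j : ι, ∃ l, l ≠ i ∧ l ≠ j)
    {i i' : ι} (hii' : i ≠ i') (hmin : ∀ l, l ≠ i' → (C i).card ≤ (C l).card) (g : G ≃g G)
    (hne : (C i ∩ (C i).map g.toEquiv.toEmbedding).Nonempty) :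
    (C i).map g.toEquiv.toEmbedding = C i := by
  have h' := h.map g
  set D : ι → Finset V := fun i => (C i).map g.toEquiv.toEmbedding with hD
  set T := S.map g.toEquiv.toEmbedding with hT
  change (C i ∩ D i).Nonempty at hne
  change D i = C i
  have hTcard : T.card = d := by rw [hT, Finset.card_map, hS]
  have hDcard : (D i).card = (C i).card := Finset.card_map _
  have hcorner : ∀ a b, (C a ∩ D b).Nonempty →
      d ≤ (S ∩ D b).card + (T ∩ C a).card + (S ∩ T).card := by
    intro a b hab
    obtain ⟨l, hla, -⟩ := hthree a a
    exact (hκ _ hab (h.inter_union_outerBoundary_ne_univ hla.symm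
      Finset.inter_subset_left)).trans (card_corner h h' a b)
  have hbd : ∀ l, G.outerBoundary (C l) = S := by
    intro l
    obtain ⟨l', hl', -⟩ := hthree l l
    refine Finset.eq_of_subset_of_card_le (h.outerBoundary_subset l) ?_
    rw [hS]
    exact hκ _ (h.nonempty l) (h.inter_union_outerBoundary_ne_univ hl'.symm subset_rfl)
  have hcii := hcorner i i hne
  -- Such a `w` gives a second nonempty corner. The two corner bounds together exhaust `|S| + |T| =
  -- 2 * d`, so `T` misses every third component `C l`, which then lies in a single `D b`.
  by_cases hw : ∃ w, w ∉ S ∧ w ∉ T ∧ w ∉ C i ∧ w ∉ D i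
  · obtain ⟨w, hwS, hwT, hwC, hwD⟩ := hw
    obtain ⟨p, hp⟩ := h.exists_mem w hwS
    obtain ⟨q, hq⟩ := h'.exists_mem w hwT
    have hip : i ≠ p := by rintro rfl; exact hwC hp
    have hiq : i ≠ q := by rintro rfl; exact hwD hq
    have hcpq := hcorner p q ⟨w, Finset.mem_inter.2 ⟨hp, hq⟩⟩
    have hTS : (T ∩ S).card = (S ∩ T).card := by rw [Finset.inter_comm]
    have hs := card_inter_add_le h' hiq S
    have ht := card_inter_add_le h hip T
    obtain ⟨l, hli, hlp⟩ := hthree i p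
    have htl := card_inter_add_add_le h hip hli.symm hlp.symm T
    have hTl : T ∩ C l = ∅ := by
      rw [← Finset.card_eq_zero]
      omega
    obtain ⟨v, hv⟩ := h.nonempty l
    have hvT : v ∉ T := fun hvT => by
      have := Finset.mem_inter.2 ⟨hvT, hv⟩
      simp [hTl] at this
    obtain ⟨b, hb⟩ := h'.exists_mem v hvT
    have hlb := subset_of_disjoint h h' hTl ⟨v, Finset.mem_inter.2 ⟨hv, hb⟩⟩
    -- The boundary of `C l` is all of `S`, so outside `T` the set `S` is confined to `D b`.
    have hSb : ∀ s ∈ S, s ∈ D b ∨ s ∈ T := by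
      intro s hs
      rw [← hbd l] at hs
      obtain ⟨-, x, hx, hxs⟩ := mem_outerBoundary.1 hs
      by_contra! hcon
      exact hcon.1 (h'.mem_of_adj b x (hlb hx) s hcon.2 hxs)
    have hzero : ∀ b', b ≠ b' → S ∩ D b' = ∅ := by
      intro b' hbb'
      rw [Finset.eq_empty_iff_forall_notMem]
      intro s hs
      obtain ⟨hs, hsD⟩ := Finset.mem_inter.1 hs
      rcases hSb s hs with hsb | hsT
      · exact hbb' (h'.eq_of_mem b b' s hsb hsD)
      · exact h'.notMem b' s hsD hsT
    by_cases hbi : b = i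
    · have := hzero q (hbi ▸ hiq)
      rw [this, Finset.card_empty] at hcpq
      have hTi : T ∩ C i = ∅ := by
        rw [← Finset.card_eq_zero]
        omega
      exact (Finset.eq_of_subset_of_card_le (subset_of_disjoint h h' hTi hne) hDcard.le).symm
    · rw [Finset.inter_comm] at hne
      exact Finset.eq_of_subset_of_card_le (subset_of_disjoint h' h (hzero i hbi) hne) hDcard.ge
  -- If the four sets cover `V`, the corner bound gives `|V| ≤ |C i ∪ D i| + d < 2|C i| + d`. But
  -- `S`, `C i`, `C l` and the nonempty `C i'` are disjoint, with `|C l| ≥ |C i|`.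
  · exfalso
    push Not at hw
    have hVle : Fintype.card V ≤ (C i ∪ D i).card + (S ∩ T).card + (S \ (D i ∪ T)).card +
        (T \ (C i ∪ S)).card := by
      rw [← Finset.card_univ]
      refine le_trans (Finset.card_le_card (t := (C i ∪ D i) ∪ (S ∩ T) ∪ (S \ (D i ∪ T)) ∪
        (T \ (C i ∪ S))) ?_) ((Finset.card_union_le _ _).trans (Nat.add_le_add_right
          ((Finset.card_union_le _ _).trans (Nat.add_le_add_right
            (Finset.card_union_le _ _) _)) _))
      intro v _
      have := hw v
      simp only [Finset.mem_union, Finset.mem_inter, Finset.mem_sdiff]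
      tauto
    have hSle : (S \ (D i ∪ T)).card + ((S ∩ D i).card + (S ∩ T).card) = d := by
      rw [← Finset.card_union_of_disjoint, ← Finset.inter_union_distrib_left,
        Finset.card_sdiff_add_card_inter, hS]
      rw [Finset.disjoint_left]
      intro v hv hv'
      exact h'.notMem i v (Finset.mem_inter.1 hv).2 (Finset.mem_inter.1 hv').2
    have hTle : (T \ (C i ∪ S)).card + ((T ∩ C i).card + (T ∩ S).card) = d := by
      rw [← Finset.card_union_of_disjoint, ← Finset.inter_union_distrib_left,
        Finset.card_sdiff_add_card_inter, hTcard]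
      rw [Finset.disjoint_left]
      intro v hv hv'
      exact h.notMem i v (Finset.mem_inter.1 hv).2 (Finset.mem_inter.1 hv').2
    rw [Finset.inter_comm T S] at hTle
    obtain ⟨l, hli, hli'⟩ := hthree i i'
    have hVge := card_inter_add_add_le h hii' hli.symm hli'.symm Finset.univ
    simp only [Finset.univ_inter, Finset.card_univ] at hVge
    have h1 := hmin l hli'
    have h2 := Finset.card_pos.2 (h.nonempty i')
    have h3 := Finset.card_union_add_card_inter (C i) (D i)
    have h4 := Finset.card_pos.2 hne
    omega

/-- In a connected arc-transitive graph of degree `d` without twins, the removal of `d` vertices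
leaves at most two components. -/
theorem false_of_three [Fintype ι] (h : G.IsShattering S C) (d : ℕ)
    (hdeg : ∀ v, (G.outerBoundary {v}).card = d)
    (harc : ∀ x y z, G.Adj x y → G.Adj x z → ∃ g : G ≃g G, g x = x ∧ g y = z)
    (hconn : ∀ U : Finset V, U.Nonempty → (∀ x ∈ U, ∀ y, G.Adj x y → y ∈ U) → U = Finset.univ)
    (htwin : ∀ x y, G.outerBoundary {x} = G.outerBoundary {y} → x = y)
    (hS : S.card = d) (hι : 3 ≤ Fintype.card ι) : False := by
  classical
  have hthree : ∀ i j : ι, ∃ l, l ≠ i ∧ l ≠ j := by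
    intro i j
    by_contra! hcon
    have : (Finset.univ : Finset ι) ⊆ {i, j} := by
      intro l _
      have := hcon l
      simp
      tauto
    have := (Finset.card_le_card this).trans Finset.card_le_two
    rw [Finset.card_univ] at this
    omega
  have hκ := le_card_outerBoundary d hdeg harc hconn
  -- Such a component is an independent block, so all `d` neighbours of each of its vertices lie in
  -- `S`, which has size `d`.
  have key : ∀ i i' : ι, i ≠ i' → (∀ l, l ≠ i' → (C i).card ≤ (C l).card) →
      ∃ x ∈ C i, G.outerBoundary {x} = S := by
    intro i i' hii' hmin
    have hind := not_adj_of_block harc hconn (C i) (by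
      intro hun
      obtain ⟨v, hv⟩ := h.nonempty i'
      exact hii' (h.eq_of_mem i i' v (hun ▸ Finset.mem_univ v) hv))
      (h.map_eq_of_inter_nonempty d hκ hS hthree hii' hmin)
    obtain ⟨x, hx⟩ := h.nonempty i
    refine ⟨x, hx, Finset.eq_of_subset_of_card_le ?_ (by rw [hS, hdeg])⟩
    intro v hv
    obtain ⟨hv, y, hy, hyv⟩ := mem_outerBoundary.1 hv
    rw [Finset.mem_singleton] at hy
    subst hy
    by_contra hvS
    exact hind _ hx _ (h.mem_of_adj i _ hx v hvS hyv) hyv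
  have : Nonempty ι := Fintype.card_pos_iff.1 (by omega)
  -- The permitted exception lets `key` apply to both the smallest and the second smallest
  -- component, which yields twins.
  obtain ⟨i, -, hi⟩ := Finset.exists_min_image (Finset.univ : Finset ι) (fun i => (C i).card)
    Finset.univ_nonempty
  obtain ⟨j, hj, hjm⟩ := Finset.exists_min_image (Finset.univ.erase i) (fun i => (C i).card) (by
    obtain ⟨l, hl, -⟩ := hthree i i
    exact ⟨l, by simp [hl]⟩)
  have hji := Finset.ne_of_mem_erase hj
  obtain ⟨x, hx, hxS⟩ := key i j hji.symm (fun l _ => hi l (Finset.mem_univ l))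
  obtain ⟨y, hy, hyS⟩ := key j i hji (fun l hl => hjm l (by simp [hl]))
  have := htwin x y (hxS.trans hyS.symm)
  subst this
  exact hji (h.eq_of_mem j i _ hy hx)

end IsShattering

open Classical in
/-- The vertices of a component of the graph with `S` deleted. -/
noncomputable def deletedPiece (G : SimpleGraph V) (S : Finset V)
    (K : (G.induce ((S : Set V)ᶜ)).ConnectedComponent) : Finset V :=
  {v | ∃ hv : v ∈ ((S : Set V)ᶜ), (G.induce ((S : Set V)ᶜ)).connectedComponentMk ⟨v, hv⟩ = K}

theorem mem_deletedPiece {S : Finset V} {K : (G.induce ((S : Set V)ᶜ)).ConnectedComponent}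
    {v : V} : v ∈ G.deletedPiece S K ↔ ∃ hv : v ∈ ((S : Set V)ᶜ),
      (G.induce ((S : Set V)ᶜ)).connectedComponentMk ⟨v, hv⟩ = K := by
  simp [deletedPiece]

theorem isShattering_deletedPiece (G : SimpleGraph V) (S : Finset V) :
    G.IsShattering S (G.deletedPiece S) where
  nonempty K := by
    induction K using ConnectedComponent.ind with
    | _ v => exact ⟨v.1, mem_deletedPiece.2 ⟨v.2, rfl⟩⟩
  eq_of_mem K L v hK hL := by
    obtain ⟨h1, rfl⟩ := mem_deletedPiece.1 hK
    obtain ⟨h2, rfl⟩ := mem_deletedPiece.1 hL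
    rfl
  notMem K v hv := by
    obtain ⟨h1, -⟩ := mem_deletedPiece.1 hv
    simpa using h1
  exists_mem v hv := ⟨_, mem_deletedPiece.2 ⟨by simpa using hv, rfl⟩⟩
  mem_of_adj K v hv w hw hvw := by
    obtain ⟨h1, rfl⟩ := mem_deletedPiece.1 hv
    refine mem_deletedPiece.2 ⟨by simpa using hw, ?_⟩
    rw [ConnectedComponent.eq]
    exact Adj.reachable (by simpa using hvw.symm)
  subset_of_closed K Y hne hcl := by
    obtain ⟨y, hy⟩ := hne
    obtain ⟨hyK, hyY⟩ := Finset.mem_inter.1 hy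
    obtain ⟨hyS, rfl⟩ := mem_deletedPiece.1 hyK
    intro z hz
    obtain ⟨hzS, hzK⟩ := mem_deletedPiece.1 hz
    have hreach := (ConnectedComponent.eq.1 hzK).symm
    rw [reachable_iff_reflTransGen] at hreach
    have : ∀ b : ((S : Set V)ᶜ : Set V),
        Relation.ReflTransGen (G.induce ((S : Set V)ᶜ)).Adj ⟨y, hyS⟩ b → b.1 ∈ Y := by
      intro b hb
      induction hb with
      | refl => exact hyY
      | @tail p q hp hpq ih =>
        have hpK : ∀ p, Relation.ReflTransGen (G.induce ((S : Set V)ᶜ)).Adj ⟨y, hyS⟩ p →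
            p.1 ∈ G.deletedPiece S ((G.induce ((S : Set V)ᶜ)).connectedComponentMk ⟨y, hyS⟩) := by
          intro p hp
          refine mem_deletedPiece.2 ⟨p.2, ConnectedComponent.eq.2 ?_⟩
          exact ((reachable_iff_reflTransGen _ _).2 hp).symm
        exact hcl _ (hpK p hp) _ (hpK q (hp.tail hpq)) (by simpa using hpq) ih
    exact this _ hreach

end SimpleGraph

/-! ### Symmetry, connectedness and independent sets of the Kneser graph -/

namespace kneserGraph

open SimpleGraph

variable {n k : ℕ}

theorem adj_iff_disjoint (hk : 0 < k) (A B : {A : Finset (Fin n) // A.card = k}) :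
    (kneserGraph n k).Adj A B ↔ Disjoint A.1 B.1 := by
  refine ⟨fun h => h.2, fun h => ⟨?_, h⟩⟩
  rintro rfl
  rw [disjoint_self, Finset.bot_eq_empty] at h
  have := A.2
  rw [h, Finset.card_empty] at this
  omega

theorem mem_outerBoundary_singleton (hk : 0 < k) (A B : {A : Finset (Fin n) // A.card = k}) :
    B ∈ (kneserGraph n k).outerBoundary {A} ↔ Disjoint A.1 B.1 := by
  rw [mem_outerBoundary, ← adj_iff_disjoint hk]
  simp only [Finset.mem_singleton, exists_eq_left, and_iff_right_iff_imp]
  rintro h rfl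
  exact (kneserGraph n k).irrefl h

theorem card_outerBoundary_singleton (hk : 0 < k) (A : {A : Finset (Fin n) // A.card = k}) :
    ((kneserGraph n k).outerBoundary {A}).card = (n - k).choose k := by
  have : (n - k).choose k = ((A.1ᶜ).powersetCard k).card := by
    rw [Finset.card_powersetCard, Finset.card_compl, Fintype.card_fin, A.2]
  rw [this, ← Finset.card_map (Function.Embedding.subtype _)]
  congr 1
  ext B
  rw [Finset.mem_map, Finset.mem_powersetCard]
  constructor
  · rintro ⟨B, hB, rfl⟩
    rw [mem_outerBoundary_singleton hk] at hB
    exact ⟨Finset.subset_compl_comm.1 (le_compl_iff_disjoint_right.2 hB), B.2⟩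
  · rintro ⟨hB, hBk⟩
    refine ⟨⟨B, hBk⟩, ?_, rfl⟩
    rw [mem_outerBoundary_singleton hk]
    exact le_compl_iff_disjoint_left.1 hB

/-- The automorphism of the Kneser graph induced by a permutation of the points. -/
def autOfPerm (σ : Equiv.Perm (Fin n)) : kneserGraph n k ≃g kneserGraph n k where
  toFun A := ⟨A.1.map σ.toEmbedding, by rw [Finset.card_map, A.2]⟩
  invFun A := ⟨A.1.map σ.symm.toEmbedding, by rw [Finset.card_map, A.2]⟩
  left_inv A := by
    ext x
    simp
  right_inv A := by
    ext x
    simp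
  map_rel_iff' := by
    intro A B
    simp [kneserGraph, Subtype.ext_iff]

/-- `B` and `C` are `k`-subsets of the complement of `A`, so a permutation of that complement,
extended by the identity on `A`, suffices. -/
theorem exists_aut (A B C : {A : Finset (Fin n) // A.card = k})
    (hAB : (kneserGraph n k).Adj A B) (hAC : (kneserGraph n k).Adj A C) :
    ∃ g : kneserGraph n k ≃g kneserGraph n k, g A = A ∧ g B = C := by
  classical
  have hcard : ∀ D : {A : Finset (Fin n) // A.card = k}, Disjoint A.1 D.1 →
      Fintype.card {y : {x // x ∉ A.1} // y.1 ∈ D.1} = k := by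
    intro D hD
    rw [Fintype.card_congr (Equiv.subtypeSubtypeEquivSubtype
      (p := fun x => x ∉ A.1) (q := fun x => x ∈ D.1)
      (fun hx hxA => Finset.disjoint_left.1 hD hxA hx)), Fintype.card_coe, D.2]
  obtain ⟨e⟩ := Fintype.card_eq.1 ((hcard B hAB.2).trans (hcard C hAC.2).symm)
  set σ : Equiv.Perm (Fin n) := Equiv.Perm.ofSubtype e.extendSubtype with hσ
  refine ⟨autOfPerm σ, Subtype.ext ?_, Subtype.ext ?_⟩
  · apply Finset.eq_of_subset_of_card_le
    · intro x hx
      obtain ⟨a, ha, rfl⟩ := Finset.mem_map.1 hx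
      have : σ a = a := Equiv.Perm.ofSubtype_apply_of_not_mem _ (by simpa using ha)
      simpa [this] using ha
    · exact (A.2.trans (autOfPerm σ A).2.symm).le
  · apply Finset.eq_of_subset_of_card_le
    · intro x hx
      obtain ⟨b, hb, rfl⟩ := Finset.mem_map.1 hx
      have hbA : b ∉ A.1 := fun h => Finset.disjoint_left.1 hAB.2 h hb
      have : σ b = e.extendSubtype ⟨b, hbA⟩ :=
        Equiv.Perm.ofSubtype_apply_of_mem (p := fun x => x ∉ A.1) _ hbA
      have h2 := e.extendSubtype_mem ⟨b, hbA⟩ hb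
      simpa [this] using h2
    · exact (C.2.trans (autOfPerm σ B).2.symm).le

/-- Two `k`-sets differing by one exchange span `k + 1` points, and `n - (k + 1) ≥ k` leaves room
for a common neighbour. Exchanges link all `k`-sets, which is `initial_of_shift_stable` for the
trivial relation. -/
theorem eq_univ_of_closed (hn : 2 * k + 1 ≤ n)
    (U : Finset {A : Finset (Fin n) // A.card = k}) (hU : U.Nonempty)
    (hcl : ∀ A ∈ U, ∀ B, (kneserGraph n k).Adj A B → B ∈ U) : U = Finset.univ := by
  rcases Nat.eq_zero_or_pos k with rfl | hk
  · obtain ⟨A, hA⟩ := hU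
    rw [Finset.eq_univ_iff_forall]
    intro B
    convert hA
    rw [Subtype.ext_iff, Finset.card_eq_zero.1 A.2, Finset.card_eq_zero.1 B.2]
  obtain ⟨A, hA⟩ := hU
  rw [Finset.eq_univ_iff_forall]
  intro B
  have := initial_of_shift_stable (fun _ _ : Fin n => True)
    (fun X => ∃ h : X.card = k, (⟨X, h⟩ : {A : Finset (Fin n) // A.card = k}) ∈ U)
    Finset.univ B.1 (Finset.subset_univ _) (fun _ _ _ _ _ => trivial) ?_ A.1 ⟨A.2, hA⟩
    (Finset.subset_univ _) (A.2.trans B.2.symm)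
  · exact this.2
  · rintro X ⟨hX, hXU⟩ - i - j hj - hi
    have hcard : (insert i (X.erase j)).card = k := by
      rw [Finset.card_insert_of_notMem (by simp [hi]), Finset.card_erase_add_one hj, hX]
    obtain ⟨D, hD, hDk⟩ := Finset.exists_subset_card_eq (s := (insert i X)ᶜ) (n := k) (by
      rw [Finset.card_compl, Finset.card_insert_of_notMem hi, Fintype.card_fin, hX]
      omega)
    have hD' := le_compl_iff_disjoint_left.1 hD
    have hDU := hcl _ hXU ⟨D, hDk⟩ ((adj_iff_disjoint hk _ _).2
      (hD'.mono_left (Finset.subset_insert _ _)))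
    refine ⟨hcard, hcl _ hDU _ ((adj_iff_disjoint hk _ _).2 ?_)⟩
    exact (hD'.mono_left (Finset.insert_subset_insert _ (Finset.erase_subset _ _))).symm

theorem eq_of_outerBoundary_eq (hk : 0 < k) (hn : 2 * k ≤ n)
    (A B : {A : Finset (Fin n) // A.card = k})
    (h : (kneserGraph n k).outerBoundary {A} = (kneserGraph n k).outerBoundary {B}) : A = B := by
  by_contra hne
  have : ¬ B.1 ⊆ A.1 := fun hBA => hne (Subtype.ext
    (Finset.eq_of_subset_of_card_le hBA (A.2.trans B.2.symm).le).symm)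
  obtain ⟨b, hbB, hbA⟩ := Finset.not_subset.1 this
  obtain ⟨C, hC1, hC2, hC⟩ := Finset.exists_subsuperset_card_eq (n := k) (s := {b}) (t := A.1ᶜ)
    (by simpa using hbA) (by rw [Finset.card_singleton]; omega) (by
      rw [Finset.card_compl, Fintype.card_fin, A.2]
      omega)
  have hCA := (mem_outerBoundary_singleton hk A ⟨C, hC⟩).2 (le_compl_iff_disjoint_left.1 hC2)
  rw [h, mem_outerBoundary_singleton hk] at hCA
  exact Finset.disjoint_left.1 hCA hbB (hC1 (by simp))

theorem intersecting_of_isIndepSet (hk : 0 < k) {t : Finset {A : Finset (Fin n) // A.card = k}}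
    (ht : (kneserGraph n k).IsIndepSet t) :
    ((t.map (Function.Embedding.subtype _) : Finset (Finset (Fin n))) :
      Set (Finset (Fin n))).Intersecting := by
  intro A hA B hB hd
  obtain ⟨A, hAt, rfl⟩ := Finset.mem_map.1 (Finset.mem_coe.1 hA)
  obtain ⟨B, hBt, rfl⟩ := Finset.mem_map.1 (Finset.mem_coe.1 hB)
  have hadj := (adj_iff_disjoint hk A B).2 hd
  exact ht hAt hBt hadj.1 hadj

theorem card_le_of_isIndepSet (hk : 0 < k) (hn : 2 * k ≤ n)
    {t : Finset {A : Finset (Fin n) // A.card = k}} (ht : (kneserGraph n k).IsIndepSet t) :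
    t.card ≤ (n - 1).choose (k - 1) := by
  rw [← Finset.card_map (Function.Embedding.subtype _)]
  refine Finset.erdos_ko_rado (intersecting_of_isIndepSet hk ht) ?_ (by omega)
  intro A hA
  obtain ⟨A, -, rfl⟩ := Finset.mem_map.1 (Finset.mem_coe.1 hA)
  exact A.2

theorem exists_isIndepSet (hk : 0 < k) (hn : 0 < n) :
    ∃ t : Finset {A : Finset (Fin n) // A.card = k}, (kneserGraph n k).IsIndepSet t ∧
      (n - 1).choose (k - 1) ≤ t.card := by
  set x : Fin n := ⟨0, hn⟩
  refine ⟨Finset.univ.filter (fun A => x ∈ A.1), ?_, ?_⟩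
  · intro A hA B hB _ hadj
    have hA := (Finset.mem_filter.1 hA).2
    have hB := (Finset.mem_filter.1 hB).2
    exact Finset.disjoint_left.1 hadj.2 hA hB
  · have h1 : (n - 1).choose (k - 1) = ((Finset.univ.erase x).powersetCard (k - 1)).card := by
      rw [Finset.card_powersetCard, Finset.card_erase_of_mem (Finset.mem_univ x),
        Finset.card_univ, Fintype.card_fin]
    have hx : ∀ A ∈ (Finset.univ.erase x).powersetCard (k - 1), x ∉ A := fun A hA h => by
      have := (Finset.mem_powersetCard.1 hA).1 h
      simp at this
    rw [h1, ← Finset.card_image_of_injOn (f := fun A => insert x A),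
      ← Finset.card_map (Function.Embedding.subtype _)]
    · apply Finset.card_le_card
      intro B hB
      obtain ⟨A, hA, rfl⟩ := Finset.mem_image.1 hB
      have hcard : (insert x A).card = k := by
        rw [Finset.card_insert_of_notMem (hx A hA), (Finset.mem_powersetCard.1 hA).2]
        omega
      exact Finset.mem_map.2 ⟨⟨_, hcard⟩, by simp, rfl⟩
    · intro A hA B hB h
      rw [← Finset.erase_insert (hx A hA), ← Finset.erase_insert (hx B hB)]
      exact congrArg (fun C => Finset.erase C x) h

/-- If the deletion of `S` leaves an edge, the number `c` of components is at most the
Hilton–Milner number. -/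
theorem card_components_add_choose_le (hk : 2 ≤ k) (hn : 2 * k ≤ n)
    {S : Finset {A : Finset (Fin n) // A.card = k}} {ι : Type*} [Fintype ι]
    {C : ι → Finset {A : Finset (Fin n) // A.card = k}}
    (h : (kneserGraph n k).IsShattering S C) {A B : {A : Finset (Fin n) // A.card = k}}
    (hA : A ∉ S) (hB : B ∉ S) (hAB : (kneserGraph n k).Adj A B) :
    Fintype.card ι + (n - k - 1).choose (k - 1) ≤ (n - 1).choose (k - 1) + 1 := by
  classical
  have hk0 : 0 < k := by omega
  obtain ⟨i₀, hAi⟩ := h.exists_mem A hA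
  have hBi := h.mem_of_adj i₀ A hAi B hB hAB
  have hmeet : ∀ i j : ι, i ≠ j → ∀ X ∈ C i, ∀ Y ∈ C j, ¬ Disjoint X.1 Y.1 := by
    intro i j hij X hX Y hY hd
    exact hij (h.eq_of_mem i j Y (h.mem_of_adj i X hX Y (h.notMem j Y hY)
      ((adj_iff_disjoint hk0 X Y).2 hd)) hY)
  choose f₀ hf₀ using h.nonempty
  -- Representing the component of the edge by `A` keeps `B` available as a set that all other
  -- representatives must meet.
  set f := Function.update f₀ i₀ A with hf_def
  have hf : ∀ i, f i ∈ C i := by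
    intro i
    by_cases hi : i = i₀
    · subst hi
      simpa [hf_def] using hAi
    · simpa [hf_def, hi] using hf₀ i
  have hfA : f i₀ = A := by simp [hf_def]
  have hinj : Function.Injective (fun i => (f i).1) := fun i j hij =>
    h.eq_of_mem i j (f i) (hf i) (by rw [Subtype.ext hij]; exact hf j)
  set 𝒜 := Finset.univ.image (fun i => (f i).1) with h𝒜
  have h𝒜card : 𝒜.card = Fintype.card ι := by
    rw [h𝒜, Finset.card_image_of_injective _ hinj, Finset.card_univ]
  by_cases hnt : ∀ x, ∃ X ∈ 𝒜, x ∉ X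
  · rw [← h𝒜card]
    refine hilton_milner hk hn 𝒜 ?_ ?_ hnt
    · intro X hX Y hY
      obtain ⟨i, -, rfl⟩ := Finset.mem_image.1 (Finset.mem_coe.1 hX)
      obtain ⟨j, -, rfl⟩ := Finset.mem_image.1 (Finset.mem_coe.1 hY)
      by_cases hij : i = j
      · subst hij
        rw [disjoint_self, Finset.bot_eq_empty, ← Finset.card_eq_zero, (f i).2]
        omega
      · exact hmeet i j hij _ (hf i) _ (hf j)
    · intro X hX
      obtain ⟨i, -, rfl⟩ := Finset.mem_image.1 (Finset.mem_coe.1 hX)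
      exact (f i).2
  · push Not at hnt
    obtain ⟨x, hx⟩ := hnt
    have hxA : x ∈ A.1 := hfA ▸ hx _ (Finset.mem_image_of_mem _ (Finset.mem_univ i₀))
    -- The common point lies in `A`, hence not in `B`. The other representatives are counted by the
    -- star bound, and the `+ 1` accounts for `A`.
    have := card_add_choose_of_star ((Finset.univ.erase i₀).image (fun i => (f i).1))
      Finset.univ B.1 x k (Finset.mem_univ x) (Finset.subset_univ _)
      (fun hxB => Finset.disjoint_left.1 hAB.2 hxA hxB) ?_
    · rw [Finset.card_image_of_injective _ hinj, Finset.card_erase_of_mem (Finset.mem_univ _),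
        Finset.card_univ, Finset.card_univ, Fintype.card_fin, B.2, Nat.sub_right_comm] at this
      omega
    · intro X hX
      obtain ⟨i, hi, rfl⟩ := Finset.mem_image.1 hX
      exact ⟨Finset.subset_univ _, (f i).2, hx _ (Finset.mem_image_of_mem _ (Finset.mem_univ i)),
        hmeet i i₀ (Finset.ne_of_mem_erase hi) _ (hf i) _ hBi⟩

end kneserGraph

/-! ### Comparison of `|S|` with the number of components -/

namespace SimpleGraph.IsShattering

variable {V : Type*} [Fintype V] [DecidableEq V] {G : SimpleGraph V} {S : Finset V} {ι : Type*}
  [Fintype ι] {C : ι → Finset V}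

/-- With no edges left, every component is a single vertex. -/
theorem card_eq_card_compl (h : G.IsShattering S C) (hS : G.IsIndepSet (Sᶜ : Finset V)) :
    Fintype.card ι = Sᶜ.card := by
  have hadj : ∀ i, ∀ v ∈ C i, ∀ w ∈ C i, ¬ G.Adj v w := by
    intro i v hv w hw hvw
    exact hS (by simpa using h.notMem i v hv) (by simpa using h.notMem i w hw) hvw.ne hvw
  choose f hf using h.nonempty
  have hinj : Function.Injective f := fun i j hij => h.eq_of_mem i j (f i) (hf i) (hij ▸ hf j)
  rw [← Finset.card_univ, ← Finset.card_image_of_injective _ hinj]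
  congr 1
  ext v
  simp only [Finset.mem_image, Finset.mem_univ, true_and, Finset.mem_compl]
  constructor
  · rintro ⟨i, rfl⟩
    exact h.notMem i _ (hf i)
  · intro hv
    obtain ⟨i, hi⟩ := h.exists_mem v hv
    have := h.subset_of_closed i {v} ⟨v, by simpa using hi⟩
      (fun a ha b hb hab _ => absurd hab (hadj i a ha b hb)) (hf i)
    exact ⟨i, by simpa using this⟩

end SimpleGraph.IsShattering

theorem sub_one_le_div_iff {n k s c : ℕ} (hk : 0 < k) (hc : 0 < c) :
    (n : ℝ) / k - 1 ≤ (s : ℝ) / c ↔ n * c ≤ k * (s + c) := by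
  have hk' : (0 : ℝ) < k := by exact_mod_cast hk
  have hc' : (0 : ℝ) < c := by exact_mod_cast hc
  rw [sub_le_iff_le_add, div_add_one hc'.ne', div_le_div_iff₀ hk' hc', mul_comm _ (k : ℝ)]
  exact_mod_cast Iff.rfl

theorem div_eq_sub_one_iff {n k s c : ℕ} (hk : 0 < k) (hc : 0 < c) :
    (s : ℝ) / c = (n : ℝ) / k - 1 ↔ n * c = k * (s + c) := by
  have hk' : (0 : ℝ) < k := by exact_mod_cast hk
  have hc' : (0 : ℝ) < c := by exact_mod_cast hc
  rw [eq_comm, sub_eq_iff_eq_add, div_add_one hc'.ne', div_eq_div_iff hk'.ne' hc'.ne',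
    mul_comm _ (k : ℝ)]
  exact_mod_cast Iff.rfl

theorem theorem3p1 (n k : ℕ) (hk : 3 ≤ k) (hn : 2 * k + 1 ≤ n)
    (S : Finset {A : Finset (Fin n) // A.card = k})
    (hS : (kneserGraph n k).IsVertexCut S)
    (c : ℕ) (hc : c = (kneserGraph n k).numComponentsDelete S) :
    (((n - k - 1).choose (k - 1) : ℤ) + 1 ≤ (c : ℤ) ∧
      (c : ℤ) ≤ ((n - 1).choose (k - 1) : ℤ) - ((n - k - 1).choose (k - 1) : ℤ) + 1) ∨
    ((S.card : ℝ) / (c : ℝ) ≥ (n : ℝ) / (k : ℝ) - 1 ∧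
      ((S.card : ℝ) / (c : ℝ) = (n : ℝ) / (k : ℝ) - 1 ↔
        (kneserGraph n k).IsMaximumIndepSet Sᶜ)) := by
  classical
  have hk0 : 0 < k := by omega
  set G := kneserGraph n k with hG
  have : Fintype (G.induce ((S : Set {A : Finset (Fin n) // A.card = k})ᶜ)).ConnectedComponent :=
    Fintype.ofFinite _
  have hsh := G.isShattering_deletedPiece S
  have hcι : Fintype.card
      (G.induce ((S : Set {A : Finset (Fin n) // A.card = k})ᶜ)).ConnectedComponent = c := by
    rw [hc, SimpleGraph.numComponentsDelete, Nat.card_eq_fintype_card]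
  obtain ⟨i, j, hij⟩ : ∃ i j :
      (G.induce ((S : Set {A : Finset (Fin n) // A.card = k})ᶜ)).ConnectedComponent, i ≠ j := by
    by_contra! hall
    exact hS fun u v => SimpleGraph.ConnectedComponent.eq.1 (hall _ _)
  have hc0 : 0 < c := by
    rw [← hcι]
    exact Fintype.card_pos_iff.2 ⟨i⟩
  rw [ge_iff_le, sub_one_le_div_iff hk0 hc0, div_eq_sub_one_iff hk0 hc0]
  by_cases hind : G.IsIndepSet (Sᶜ : Finset _)
  · right
    have hcS : c = Sᶜ.card := hcι ▸ hsh.card_eq_card_compl hind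
    have hsum : S.card + c = n.choose k := by
      rw [hcS, Finset.card_add_card_compl, Fintype.card_finset_len, Fintype.card_fin]
    have hmul : k * n.choose k = n * (n - 1).choose (k - 1) := by
      obtain ⟨m, rfl⟩ : ∃ m, n = m + 1 := ⟨n - 1, by omega⟩
      obtain ⟨l, rfl⟩ : ∃ l, k = l + 1 := ⟨k - 1, by omega⟩
      rw [mul_comm]
      exact (Nat.add_one_mul_choose_eq m l).symm
    have hle : c ≤ (n - 1).choose (k - 1) :=
      hcS ▸ kneserGraph.card_le_of_isIndepSet hk0 (by omega) hind
    rw [hsum, hmul]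
    refine ⟨Nat.mul_le_mul_left _ hle, ?_⟩
    rw [Nat.mul_right_inj (by omega)]
    constructor
    · intro heq
      refine ⟨hind, fun t ht => ?_⟩
      rw [← hcS, heq]
      exact kneserGraph.card_le_of_isIndepSet hk0 (by omega) ht
    · intro hmax
      obtain ⟨t, ht, htc⟩ := kneserGraph.exists_isIndepSet (n := n) hk0 (by omega)
      have := hmax.maximum t ht
      omega
  · have hnmax : ¬ G.IsMaximumIndepSet Sᶜ := fun h => hind h.isIndepSet
    obtain ⟨A, hA, B, hB, hAB⟩ : ∃ A, A ∉ S ∧ ∃ B, B ∉ S ∧ G.Adj A B := by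
      by_contra! hcon
      exact hind fun A hA B hB _ => hcon A (by simpa using hA) B (by simpa using hB)
    have hHM := kneserGraph.card_components_add_choose_le (by omega) (by omega) hsh hA hB hAB
    rw [hcι] at hHM
    -- `hHM` already supplies the upper bound of the first alternative; only its lower bound can
    -- fail.
    rcases Nat.lt_or_ge ((n - k - 1).choose (k - 1)) c with hlt | hge
    · left
      constructor <;> omega
    right
    have hdeg := kneserGraph.card_outerBoundary_singleton (n := n) hk0
    have hconn := kneserGraph.eq_univ_of_closed hn
    have hd : (n - k).choose k ≤ S.card :=
      (SimpleGraph.le_card_outerBoundary _ hdeg kneserGraph.exists_aut hconn _ (hsh.nonempty i)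
        (hsh.inter_union_outerBoundary_ne_univ hij subset_rfl)).trans
        (Finset.card_le_card (hsh.outerBoundary_subset i))
    have hmul : (n - k).choose k * k = (n - k) * (n - k - 1).choose (k - 1) := by
      obtain ⟨m, hm⟩ : ∃ m, n - k = m + 1 := ⟨n - k - 1, by omega⟩
      obtain ⟨l, rfl⟩ : ∃ l, k = l + 1 := ⟨k - 1, by omega⟩
      rw [hm]
      exact (Nat.add_one_mul_choose_eq m l).symm
    -- Since `S` is not the complement of an independent set, the ratio inequality must be strict. A
    -- smaller `c` gives this at once; for the extremal `c`, `|S| = d` is excluded by having at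
    -- least three components.
    have hstrict : (n - k) * c < k * S.card := by
      rcases hge.eq_or_lt with heq | hlt
      · have hne : S.card ≠ (n - k).choose k := by
          intro hSd
          refine hsh.false_of_three _ hdeg kneserGraph.exists_aut hconn
            (kneserGraph.eq_of_outerBoundary_eq hk0 (by omega)) hSd ?_
          rw [hcι, heq]
          calc 3 ≤ k := hk
            _ = k.choose (k - 1) := by
              obtain ⟨l, rfl⟩ : ∃ l, k = l + 1 := ⟨k - 1, by omega⟩
              rw [Nat.add_sub_cancel, Nat.choose_succ_self_right]
            _ ≤ (n - k - 1).choose (k - 1) := Nat.choose_le_choose _ (by omega)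
        rw [heq, ← hmul, mul_comm]
        exact Nat.mul_lt_mul_of_pos_left (lt_of_le_of_ne hd hne.symm) hk0
      · calc (n - k) * c < (n - k) * (n - k - 1).choose (k - 1) :=
              Nat.mul_lt_mul_of_pos_left hlt (by omega)
          _ = k * (n - k).choose k := by rw [← hmul, mul_comm]
          _ ≤ k * S.card := Nat.mul_le_mul_left _ hd
    have hlt : n * c < k * (S.card + c) := by
      have : n * c = (n - k) * c + k * c := by
        rw [← add_mul, Nat.sub_add_cancel (by omega)]
      rw [this, mul_add]
      omega
    exact ⟨hlt.le, fun h => absurd h hlt.ne, fun h => absurd h hnmax⟩
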